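/- Consider scalar linear quadratic regulators $x_{t+1}=ax_t+bu_t+w_t$, $x_1=0$, with i.i.d. noise $w_t\sim\mathcal N(0,\sigma^2)$ and costs $c_t=qx_t^2+ru_t^2$, where $q,r>0$. For a linear policy $u_t=Kx_t$ let $J(K)=\lim_{T\to\infty}\frac1T\mathbb E\big[\sum_{t=1}^Tc_t\big]\in[0,\infty]$, let $J_\star=\min_KJ(K)$, and let $R_T=\sum_{t=1}^T(c_t-J_\star)$ be the regret of a learning algorithm after $T$ rounds. A learning algorithm chooses $u_t$ as a measurable function of the observed states $x_1,\dots,x_t$ and, if it is randomized, of an internal random seed independent of the noise. Expected regrets are taken in $(-\infty,\infty]$. (i) There are universal constants $c>0$ and $T_0$ such that for every $\sigma>0$, every $T\ge T_0$ and every (possibly randomized) learning algorithm, which may depend on $\sigma$ and $T$ and may receive the parameter $a$ as input, there is a controllable ($b\ne0$) scalar system with a unique optimal policy $K_\star$, stabilized by the policy $K_0=0$ (that is, $|a|<1$ and $J(0)<\infty$), with $|q|,|r|\le1$, $|q^{-1}|,|r^{-1}|\le1$, $|a|,|b|\le1$ and $J_\star\le2\sigma^2$ (that is, $\alpha_0=\alpha_1=\vartheta=1$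 and $\nu=2\sigma^2$), on which the expected regret of the algorithm satisfies $\mathbb E[R_T]\ge c\,\sigma^2\sqrt T$. (ii) Let $\sigma>0$, $T\ge12000$ and $\epsilon=T^{-1/2}/4$, and consider the system $x_{t+1}=x_t/\sqrt5+\chi\sqrt\epsilon\,u_t+w_t$ with $x_1=0$ and costs $c_t=x_t^2+u_t^2$, where the sign $\chi$ is uniform on $\{-1,1\}$, drawn once at the start and independent of the noise. Then every deterministic learning algorithm (which may depend on $\sigma$ and $T$) satisfies $$\mathbb E[R_T]\ \ge\ \frac{\sigma^2\sqrt T}{3100}-4\sigma^2,$$ where the expectation is over both the noise and $\chi$. -/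

import Mathlib

open MeasureTheory ProbabilityTheory Filter
open scoped ENNReal NNReal

namespace ScalarControl

/-- A one-dimensional linear quadratic regulator: dynamics `x' = a x + b u + w`, instantaneous
cost `q x² + r u²` with `q, r > 0` (positive definite `1 × 1` cost matrices). -/
structure LQR where
  a : ℝ
  b : ℝ
  q : ℝ
  r : ℝ
  q_pos : 0 < q
  r_pos : 0 < r

/-- A deterministic learning algorithm: in round `t` (rounds are numbered `0, 1, 2, …`) the action
is a measurable function of the observed states `x_0, …, x_t`. -/
structure DetAlgorithm where
  act : (t : ℕ) → (Fin (t + 1) → ℝ) → ℝ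
  measurable_act : ∀ t, Measurable (act t)

/-- A (possibly randomized) learning algorithm: it draws an internal random seed `s : S` before the
first round, and its action in round `t` is a jointly measurable function of the seed and of the
observed states `x_0, …, x_t`. -/
structure Algorithm (S : Type*) [MeasurableSpace S] where
  act : (t : ℕ) → S → (Fin (t + 1) → ℝ) → ℝ
  measurable_act : ∀ t, Measurable (fun p : S × (Fin (t + 1) → ℝ) => act t p.1 p.2)

/-- The deterministic algorithm obtained by fixing the seed. -/
def Algorithm.ofSeed {S : Type*} [MeasurableSpace S] (alg : Algorithm S) (s : S) :
    DetAlgorithm where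
  act t h := alg.act t s h
  measurable_act t := (alg.measurable_act t).comp measurable_prodMk_left

/-- The linear policy `u_t = K x_t`. -/
def linearPolicy (K : ℝ) : DetAlgorithm where
  act t h := K * h (Fin.last t)
  measurable_act t := by fun_prop

/-- The law of the noise sequence `w_0, w_1, …`: i.i.d. centred Gaussians of variance `σ²`. -/
noncomputable def noise (σ : ℝ) : Measure (ℕ → ℝ) :=
  Measure.infinitePi (fun _ : ℕ => gaussianReal 0 (σ ^ 2).toNNReal)

/-- The expectation, with values in `[-∞, ∞]`, of a real random variable `f`:
`𝔼 f⁺ - 𝔼 f⁻`. It is used for variables that are bounded below (regrets), so that the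
second term is finite. -/
noncomputable def expect {Ω : Type*} [MeasurableSpace Ω] (μ : Measure Ω) (f : Ω → ℝ) : EReal :=
  ((∫⁻ ω, ENNReal.ofReal (f ω) ∂μ : ℝ≥0∞) : EReal)
    - ((∫⁻ ω, ENNReal.ofReal (-f ω) ∂μ : ℝ≥0∞) : EReal)

namespace LQR

/-- The states `x_0, …, x_t` visited by the algorithm when the noise is `w`, starting from
`x_0 = 0`, with `x_{t+1} = a x_t + b u_t + w_t`. -/
noncomputable def history (sys : LQR) (alg : DetAlgorithm) (w : ℕ → ℝ) :
    (t : ℕ) → (Fin (t + 1) → ℝ)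
  | 0 => fun _ => 0
  | t + 1 =>
    Fin.snoc (α := fun _ => ℝ) (sys.history alg w t)
      (sys.a * sys.history alg w t (Fin.last t)
        + sys.b * alg.act t (sys.history alg w t) + w t)

/-- The state `x_t`. -/
noncomputable def state (sys : LQR) (alg : DetAlgorithm) (w : ℕ → ℝ) (t : ℕ) : ℝ :=
  sys.history alg w t (Fin.last t)

/-- The action `u_t`. -/
noncomputable def action (sys : LQR) (alg : DetAlgorithm) (w : ℕ → ℝ) (t : ℕ) : ℝ :=
  alg.act t (sys.history alg w t)

/-- The instantaneous cost `c_t = q x_t² + r u_t²`. -/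
noncomputable def stepCost (sys : LQR) (alg : DetAlgorithm) (w : ℕ → ℝ) (t : ℕ) : ℝ :=
  sys.q * sys.state alg w t ^ 2 + sys.r * sys.action alg w t ^ 2

/-- The infinite horizon expected cost `J(K) = lim_T (1/T) 𝔼 ∑_{t < T} c_t` of the policy
`u_t = K x_t`, with values in `[0, ∞]`. The expected costs `𝔼 c_t` are nondecreasing in `t`
(as `x_0 = 0`), hence the limit exists for every `K`, and it equals the `limsup`. -/
noncomputable def policyCost (sys : LQR) (σ K : ℝ) : ℝ≥0∞ :=
  limsup (fun T : ℕ =>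
    (∫⁻ w, ENNReal.ofReal (∑ t ∈ Finset.range T, sys.stepCost (linearPolicy K) w t) ∂(noise σ))
      / (T : ℝ≥0∞)) atTop

/-- `K` is an optimal policy: a minimizer of `J`. -/
def IsOptimalPolicy (sys : LQR) (σ K : ℝ) : Prop :=
  ∀ K' : ℝ, sys.policyCost σ K ≤ sys.policyCost σ K'

/-- The optimal infinite horizon expected cost `J⋆ = min_K J(K)`. -/
noncomputable def optimalCost (sys : LQR) (σ : ℝ) : ℝ≥0∞ :=
  ⨅ K : ℝ, sys.policyCost σ K

/-- The regret `R_T = ∑_{t < T} (c_t - J⋆)` of a run of `T` rounds. -/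
noncomputable def regret (sys : LQR) (σ : ℝ) (alg : DetAlgorithm) (T : ℕ) (w : ℕ → ℝ) : ℝ :=
  ∑ t ∈ Finset.range T, (sys.stepCost alg w t - (sys.optimalCost σ).toReal)

/-- The expected regret of an algorithm, over its seed (with law `ρ`) and the independent noise. -/
noncomputable def expectedRegret (sys : LQR) (σ : ℝ) {S : Type*} [MeasurableSpace S]
    (ρ : Measure S) (alg : Algorithm S) (T : ℕ) : EReal :=
  expect (ρ.prod (noise σ)) (fun p => sys.regret σ (alg.ofSeed p.1) T p.2)

/-- The policy `u_t = K x_t` stabilizes the system: the closed loop is contracting and the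
infinite horizon cost is finite. -/
def StabilizedBy (sys : LQR) (σ K : ℝ) : Prop :=
  |sys.a + sys.b * K| < 1 ∧ sys.policyCost σ K < ⊤

/-- Controllability of a one-dimensional system. -/
def Controllable (sys : LQR) : Prop := sys.b ≠ 0

/-- The bounds `α₀, α₁` on the costs, `ϑ` on the transition parameters, and `ν` on `J⋆`. -/
def HasBounds (sys : LQR) (σ α₀ α₁ ϑ ν : ℝ) : Prop :=
  |sys.q| ≤ α₁ ∧ |sys.r| ≤ α₁ ∧ |sys.q⁻¹| ≤ α₀⁻¹ ∧ |sys.r⁻¹| ≤ α₀⁻¹ ∧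
    |sys.a| ≤ ϑ ∧ |sys.b| ≤ ϑ ∧ sys.optimalCost σ ≤ ENNReal.ofReal ν

end LQR

/-- The law of a fair sign: `true` stands for `χ = 1` and `false` for `χ = -1`. -/
noncomputable def fairSign : Measure Bool := (PMF.uniformOfFintype Bool).toMeasure

/-- The value `±1` of a sign. -/
def signValue (χ : Bool) : ℝ := if χ then 1 else -1

/-- The system `x' = x / √5 + χ √ε u + w` with cost `x² + u²`. -/
noncomputable def hardSystem (ε : ℝ) (χ : Bool) : LQR where
  a := 1 / √5
  b := signValue χ * √ε
  q := 1
  r := 1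
  q_pos := one_pos
  r_pos := one_pos

end ScalarControl

namespace ScalarControl

/-! Two systems that differ only in the sign of a small gain b = ±√ε share the value P x² and have
opposite optimal policies u = -kx and u = kx, with k of order √ε. Acting well requires knowing the
sign, and the sign shows only through large actions, which are themselves costly.

Completing the square in the Bellman identity and telescoping turns the expected regret into (r +
b²P) Z - P·𝔼 x_T², where Z is the expected total squared deviation from the optimal policy
(`Bellman.sum_lintegral_stepCost_add`). Since 𝔼 x_T² ≤ 5σ²/3 + 2b²Z, the regret is at least Z/2 -
4σ² (`Bellman.le_totalCost`). It remains to bound from below the sum of Z over the two signs.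

Both systems are compared with the system of gain 0, whose states ignore the actions. If X and Y are
the likelihood ratios of the gains b and -b, then XY = B² with B = exp(-∑ b²u²/(2σ²)), and the
deviations in round t add up to 𝔼[(u+kx)² X + (u-kx)² Y] under gain 0. Either 𝔼(1 - B_T) ≥ 1/40, so
that the actions carry energy of order σ²/b², far from what either policy would spend. Or B_T stays
near 1 and the signs cannot be told apart, so that each round after the first costs order k²σ². This
dichotomy is `le_sum_pairRisk`. For ε = 1/(4√T) both alternatives give order σ²√T.

A randomized algorithm is integrated over its seed, and one of the two signs must do at least as
badly as the average. Second moments are kept in [0,∞] throughout, because an algorithm may have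
infinite expected cost. -/

instance isProbabilityMeasure_noise (σ : ℝ) : IsProbabilityMeasure (noise σ) := by
  unfold noise; infer_instance

/-! ### Measurability and causality of trajectories -/

/-- A deterministic algorithm, regarded as a randomized one that ignores its seed. -/
def DetAlgorithm.toAlgorithm (S : Type*) [MeasurableSpace S] (alg : DetAlgorithm) :
    Algorithm S where
  act t _ h := alg.act t h
  measurable_act t := (alg.measurable_act t).comp measurable_snd

lemma measurable_finSnoc (t : ℕ) :
    Measurable (fun p : (Fin (t + 1) → ℝ) × ℝ =>
      (Fin.snoc (α := fun _ => ℝ) p.1 p.2 : Fin (t + 1 + 1) → ℝ)) := by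
  refine measurable_pi_iff.2 fun i => ?_
  refine Fin.lastCases ?_ (fun j => ?_) i
  · simpa using measurable_snd
  · simp only [Fin.snoc_castSucc]; fun_prop

namespace LQR

variable {S : Type*} [MeasurableSpace S]

/-- Measurability is joint in seed and noise so that Tonelli applies to the expected regret; a
one-point seed gives the deterministic case. -/
lemma measurable_history_seed (sys : LQR) (alg : Algorithm S) (t : ℕ) :
    Measurable (fun p : S × (ℕ → ℝ) => sys.history (alg.ofSeed p.1) p.2 t) := by
  induction t with
  | zero => exact measurable_const
  | succ t ih =>
    have hact : Measurable (fun p : S × (ℕ → ℝ) =>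
        (alg.ofSeed p.1).act t (sys.history (alg.ofSeed p.1) p.2 t)) :=
      (alg.measurable_act t).comp (measurable_fst.prodMk ih)
    have hw : Measurable (fun p : S × (ℕ → ℝ) => p.2 t) :=
      (measurable_pi_apply t).comp measurable_snd
    have hx : Measurable (fun p : S × (ℕ → ℝ) =>
        sys.history (alg.ofSeed p.1) p.2 t (Fin.last t)) :=
      (measurable_pi_apply _).comp ih
    exact (measurable_finSnoc t).comp
      (ih.prodMk (((hx.const_mul _).add (hact.const_mul _)).add hw))

lemma measurable_stepCost_seed (sys : LQR) (alg : Algorithm S) (t : ℕ) :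
    Measurable (fun p : S × (ℕ → ℝ) => sys.stepCost (alg.ofSeed p.1) p.2 t) := by
  have hh := sys.measurable_history_seed alg t
  have hact : Measurable (fun p : S × (ℕ → ℝ) => sys.action (alg.ofSeed p.1) p.2 t) :=
    (alg.measurable_act t).comp (measurable_fst.prodMk hh)
  have hx : Measurable (fun p : S × (ℕ → ℝ) => sys.state (alg.ofSeed p.1) p.2 t) :=
    (measurable_pi_apply _).comp hh
  exact ((hx.pow_const 2).const_mul _).add ((hact.pow_const 2).const_mul _)

variable (sys : LQR) (alg : DetAlgorithm)

@[fun_prop]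
lemma measurable_history (t : ℕ) : Measurable (fun w => sys.history alg w t) :=
  (sys.measurable_history_seed (alg.toAlgorithm Unit) t).comp
    (measurable_prodMk_left (x := ()))

@[fun_prop]
lemma measurable_state (t : ℕ) : Measurable (fun w => sys.state alg w t) :=
  (measurable_pi_apply _).comp (sys.measurable_history alg t)

@[fun_prop]
lemma measurable_action (t : ℕ) : Measurable (fun w => sys.action alg w t) :=
  (alg.measurable_act t).comp (sys.measurable_history alg t)

@[fun_prop]
lemma measurable_stepCost (t : ℕ) : Measurable (fun w => sys.stepCost alg w t) := by
  unfold stepCost; fun_prop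

/-- Causality: the noise of round t first enters in x_{t+1}. Hence w_t can be resampled with
everything up to x_t and u_t frozen, which replaces conditioning on the past. -/
lemma history_congr {w w' : ℕ → ℝ} {t : ℕ} (h : ∀ s < t, w s = w' s) :
    sys.history alg w t = sys.history alg w' t := by
  induction t with
  | zero => rfl
  | succ t ih =>
    simp only [history, ih fun s hs => h s (hs.trans t.lt_succ_self), h t t.lt_succ_self]

lemma history_update (w : ℕ → ℝ) {s t : ℕ} (hst : s ≤ t) (y : ℝ) :
    sys.history alg (Function.update w t y) s = sys.history alg w s :=
  sys.history_congr alg fun r hr => Function.update_of_ne (by omega) _ _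

lemma state_update (w : ℕ → ℝ) {s t : ℕ} (hst : s ≤ t) (y : ℝ) :
    sys.state alg (Function.update w t y) s = sys.state alg w s := by
  simp only [state, sys.history_update alg w hst]

lemma action_update (w : ℕ → ℝ) {s t : ℕ} (hst : s ≤ t) (y : ℝ) :
    sys.action alg (Function.update w t y) s = sys.action alg w s := by
  simp only [action, sys.history_update alg w hst]

lemma state_zero (w : ℕ → ℝ) : sys.state alg w 0 = 0 := rfl

lemma state_succ (w : ℕ → ℝ) (t : ℕ) : sys.state alg w (t + 1) =
    sys.a * sys.state alg w t + sys.b * sys.action alg w t + w t := by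
  simp [state, history, action]

end LQR

/-! ### Resampling the noise and one-step second moments -/

/-- Resampling one coordinate of the noise does not change its law. -/
lemma lintegral_noise_update (σ : ℝ) (t : ℕ) {Φ : (ℕ → ℝ) → ℝ≥0∞} (hΦ : Measurable Φ) :
    ∫⁻ w, Φ w ∂(noise σ) =
      ∫⁻ w, ∫⁻ y, Φ (Function.update w t y) ∂(gaussianReal 0 (σ ^ 2).toNNReal) ∂(noise σ) := by
  set γ := gaussianReal 0 (σ ^ 2).toNNReal with hγ
  have hm : Measurable (fun p : (ℕ → ℝ) × ℝ => Function.update p.1 t p.2) := by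
    refine measurable_pi_iff.2 fun i => ?_
    by_cases h : i = t
    · subst h; simpa using measurable_snd
    · simp only [Function.update_of_ne h]; fun_prop
  have key : ((noise σ).prod γ).map (fun p => Function.update p.1 t p.2) = noise σ := by
    refine Measure.eq_infinitePi _ fun s B hB => ?_
    rw [Measure.map_apply hm (MeasurableSet.pi s.countable_toSet fun i _ => hB i)]
    have hset : (fun p : (ℕ → ℝ) × ℝ => Function.update p.1 t p.2) ⁻¹' Set.pi s B =
        Set.pi (s.erase t) B ×ˢ (if t ∈ s then B t else Set.univ) := by
      ext ⟨w, y⟩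
      simp only [Set.mem_preimage, Set.mem_pi, Set.mem_prod, Finset.mem_coe, Finset.mem_erase]
      constructor
      · intro h
        refine ⟨fun i hi => by simpa [Function.update_of_ne hi.1] using h i hi.2, ?_⟩
        split_ifs with ht
        · simpa using h t ht
        · trivial
      · rintro ⟨h1, h2⟩ i hi
        by_cases hit : i = t
        · subst hit; simpa [hi] using h2
        · simpa [Function.update_of_ne hit] using h1 i ⟨hit, hi⟩
    rw [hset, Measure.prod_prod]
    unfold noise
    rw [Measure.infinitePi_pi _ (fun i _ => hB i)]
    split_ifs with ht
    · rw [Finset.prod_erase_mul _ _ ht]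
    · rw [Finset.erase_eq_of_notMem ht]; simp
  conv_lhs => rw [← key]
  rw [lintegral_map hΦ hm]
  exact lintegral_prod _ (hΦ.comp hm).aemeasurable

lemma lintegral_gaussianReal_add_sq (σ m : ℝ) :
    ∫⁻ y, ENNReal.ofReal ((m + y) ^ 2) ∂(gaussianReal 0 (σ ^ 2).toNNReal) =
      ENNReal.ofReal (m ^ 2) + ENNReal.ofReal (σ ^ 2) := by
  set γ := gaussianReal 0 (σ ^ 2).toNNReal with hγ
  have hL : MemLp (fun y : ℝ => y) 2 γ := memLp_id_gaussianReal 2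
  have h2 : Integrable (fun y : ℝ => y ^ 2) γ := hL.integrable_sq
  have h1 : Integrable (fun y : ℝ => y) γ := hL.integrable one_le_two
  have hint : ∫ y, y ^ 2 ∂γ = σ ^ 2 := by
    have := variance_fun_id_gaussianReal (μ := 0) (v := (σ ^ 2).toNNReal)
    rw [variance_of_integral_eq_zero (by fun_prop) integral_id_gaussianReal] at this
    rw [hγ, this, Real.coe_toNNReal _ (sq_nonneg σ)]
  have hint1 : ∫ y, y ∂γ = 0 := integral_id_gaussianReal
  have he : ∀ y : ℝ, (m + y) ^ 2 = m ^ 2 + (2 * m * y + y ^ 2) := fun y => by ring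
  have hi : Integrable (fun y : ℝ => (m + y) ^ 2) γ := by
    simp only [he]
    exact (integrable_const _).add ((h1.const_mul _).add h2)
  rw [← ofReal_integral_eq_lintegral_ofReal hi (ae_of_all _ fun y => sq_nonneg _),
    ← ENNReal.ofReal_add (sq_nonneg _) (sq_nonneg _)]
  congr 1
  simp only [he]
  have hs : Integrable (fun y : ℝ => 2 * m * y + y ^ 2) γ := (h1.const_mul _).add h2
  rw [integral_add (integrable_const _) hs,
    integral_add (h1.const_mul _) h2, integral_const_mul, hint, hint1]
  simp

namespace LQR

variable (sys : LQR) (alg : DetAlgorithm)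

/-- One step of the second moment of the state. -/
lemma lintegral_state_succ_sq (σ : ℝ) (t : ℕ) :
    ∫⁻ w, ENNReal.ofReal (sys.state alg w (t + 1) ^ 2) ∂(noise σ) =
      ∫⁻ w, ENNReal.ofReal ((sys.a * sys.state alg w t + sys.b * sys.action alg w t) ^ 2)
        ∂(noise σ) + ENNReal.ofReal (σ ^ 2) := by
  rw [lintegral_noise_update σ t (by fun_prop)]
  simp only [state_succ, sys.state_update alg _ le_rfl, sys.action_update alg _ le_rfl,
    Function.update_self, lintegral_gaussianReal_add_sq]
  rw [lintegral_add_right _ measurable_const]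
  simp

end LQR

/-! ### Infinite horizon cost of linear policies and the size of the final state -/

namespace LQR

variable (sys : LQR)

lemma action_linearPolicy (K : ℝ) (w : ℕ → ℝ) (t : ℕ) :
    sys.action (linearPolicy K) w t = K * sys.state (linearPolicy K) w t := rfl

/-- The second moment of the state under a linear policy. -/
lemma lintegral_state_linearPolicy_sq (σ K : ℝ) (t : ℕ) :
    ∫⁻ w, ENNReal.ofReal (sys.state (linearPolicy K) w t ^ 2) ∂(noise σ) =
      ENNReal.ofReal (σ ^ 2 * ∑ s ∈ Finset.range t, ((sys.a + sys.b * K) ^ 2) ^ s) := by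
  induction t with
  | zero => simp [state_zero]
  | succ t ih =>
    have h : ∀ w, ENNReal.ofReal ((sys.a * sys.state (linearPolicy K) w t +
        sys.b * sys.action (linearPolicy K) w t) ^ 2) =
        ENNReal.ofReal ((sys.a + sys.b * K) ^ 2) *
          ENNReal.ofReal (sys.state (linearPolicy K) w t ^ 2) := fun w => by
      rw [← ENNReal.ofReal_mul (sq_nonneg _), action_linearPolicy]
      congr 1; ring
    rw [lintegral_state_succ_sq]
    simp only [h]
    rw [lintegral_const_mul _ (by fun_prop), ih, ← ENNReal.ofReal_mul (sq_nonneg _),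
      ← ENNReal.ofReal_add (by positivity) (by positivity), Finset.sum_range_succ']
    congr 1
    simp only [pow_succ _ _, ← Finset.sum_mul]
    ring

lemma lintegral_sum_stepCost_linearPolicy (σ K : ℝ) (T : ℕ) :
    ∫⁻ w, ENNReal.ofReal (∑ t ∈ Finset.range T, sys.stepCost (linearPolicy K) w t) ∂(noise σ) =
      ENNReal.ofReal (∑ t ∈ Finset.range T, (sys.q + sys.r * K ^ 2) * (σ ^ 2 *
        ∑ s ∈ Finset.range t, ((sys.a + sys.b * K) ^ 2) ^ s)) := by
  have hq := sys.q_pos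
  have hr := sys.r_pos
  have h : ∀ w t, sys.stepCost (linearPolicy K) w t =
      (sys.q + sys.r * K ^ 2) * sys.state (linearPolicy K) w t ^ 2 := fun w t => by
    rw [stepCost, action_linearPolicy]; ring
  have h0 : ∀ t, 0 ≤ ∑ s ∈ Finset.range t, ((sys.a + sys.b * K) ^ 2) ^ s := fun t =>
    Finset.sum_nonneg fun s _ => by positivity
  rw [ENNReal.ofReal_sum_of_nonneg fun t _ => by have := h0 t; positivity]
  have h1 : ∀ w, ENNReal.ofReal (∑ t ∈ Finset.range T, sys.stepCost (linearPolicy K) w t) =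
      ∑ t ∈ Finset.range T, ENNReal.ofReal
        ((sys.q + sys.r * K ^ 2) * sys.state (linearPolicy K) w t ^ 2) := fun w => by
    simp only [h]
    exact ENNReal.ofReal_sum_of_nonneg fun t _ => by positivity
  simp only [h1]
  rw [lintegral_finsetSum _ fun t _ => by fun_prop]
  refine Finset.sum_congr rfl fun t _ => ?_
  have hc : 0 ≤ sys.q + sys.r * K ^ 2 := by positivity
  simp_rw [ENNReal.ofReal_mul hc]
  rw [lintegral_const_mul _ (by fun_prop), lintegral_state_linearPolicy_sq]

lemma policyCost_eq_limsup (σ K : ℝ) :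
    sys.policyCost σ K = limsup (fun T : ℕ => ENNReal.ofReal ((T : ℝ)⁻¹ *
      ∑ t ∈ Finset.range T, (sys.q + sys.r * K ^ 2) * (σ ^ 2 *
        ∑ s ∈ Finset.range t, ((sys.a + sys.b * K) ^ 2) ^ s))) atTop := by
  unfold policyCost
  refine limsup_congr ?_
  filter_upwards [eventually_gt_atTop 0] with T hT
  rw [lintegral_sum_stepCost_linearPolicy, ENNReal.ofReal_mul (by positivity),
    ENNReal.ofReal_inv_of_pos (by positivity), ENNReal.ofReal_natCast, div_eq_mul_inv, mul_comm]

/-- The cost of a contracting linear policy. -/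
lemma policyCost_of_abs_lt_one (σ K : ℝ) (h : |sys.a + sys.b * K| < 1) :
    sys.policyCost σ K = ENNReal.ofReal
      ((sys.q + sys.r * K ^ 2) * (σ ^ 2 * (1 - (sys.a + sys.b * K) ^ 2)⁻¹)) := by
  rw [policyCost_eq_limsup]
  refine Tendsto.limsup_eq (ENNReal.tendsto_ofReal (Tendsto.cesaro ?_))
  exact ((hasSum_geometric_of_lt_one (sq_nonneg _)
    ((sq_lt_one_iff_abs_lt_one _).2 h)).tendsto_sum_nat.const_mul _).const_mul _

/-- The cost of a linear policy that is not contracting is infinite. -/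
lemma policyCost_of_one_le_abs {σ : ℝ} (hσ : 0 < σ) (K : ℝ) (h : 1 ≤ |sys.a + sys.b * K|) :
    sys.policyCost σ K = ⊤ := by
  have hq := sys.q_pos
  have hr := sys.r_pos
  set c := (sys.q + sys.r * K ^ 2) * σ ^ 2 with hc
  have hc0 : 0 < c := by positivity
  rw [policyCost_eq_limsup]
  refine Tendsto.limsup_eq (ENNReal.tendsto_ofReal_nhds_top.2 ?_)
  -- Without contraction 𝔼 x_t² ≥ tσ², so the average cost over T rounds is at least c(T-1)/2.
  have hlim : Tendsto (fun T : ℕ => c / 2 * ((T : ℝ) - 1)) atTop atTop :=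
    (tendsto_atTop_add_const_right _ _ tendsto_natCast_atTop_atTop).const_mul_atTop (by positivity)
  refine tendsto_atTop_mono' _ ?_ hlim
  filter_upwards [eventually_gt_atTop 0] with T hT
  have hT' : (0 : ℝ) < T := by exact_mod_cast hT
  have hle : ∑ t ∈ Finset.range T, c * (t : ℝ) ≤
      ∑ t ∈ Finset.range T, (sys.q + sys.r * K ^ 2) * (σ ^ 2 *
        ∑ s ∈ Finset.range t, ((sys.a + sys.b * K) ^ 2) ^ s) := by
    refine Finset.sum_le_sum fun t _ => ?_
    have h1 : (t : ℝ) ≤ ∑ s ∈ Finset.range t, ((sys.a + sys.b * K) ^ 2) ^ s := by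
      calc (t : ℝ) = ∑ s ∈ Finset.range t, (1 : ℝ) := by simp
        _ ≤ _ := Finset.sum_le_sum fun s _ => one_le_pow₀ (by
          rw [← sq_abs]; exact one_le_pow₀ h)
    rw [hc, mul_assoc]
    gcongr
  have hsum : (∑ t ∈ Finset.range T, (t : ℝ)) * 2 = T * (T - 1) := by
    have := Finset.sum_range_id_mul_two T
    have h2 : ((∑ t ∈ Finset.range T, t : ℕ) : ℝ) * 2 = T * ((T - 1 : ℕ) : ℝ) := by
      exact_mod_cast this
    rw [Nat.cast_sub hT] at h2
    push_cast at h2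
    exact h2
  rw [← Finset.mul_sum] at hle
  calc c / 2 * ((T : ℝ) - 1) = (T : ℝ)⁻¹ * (c * ∑ t ∈ Finset.range T, (t : ℝ)) := by
        have : (∑ t ∈ Finset.range T, (t : ℝ)) = T * (T - 1) / 2 := by linarith
        rw [this]; field_simp
    _ ≤ _ := by gcongr

/-- The final state is controlled by the noise and the deviations from the optimal policy. -/
lemma lintegral_state_sq_le {K : ℝ} (hρ : 5 * (sys.a + sys.b * K) ^ 2 ≤ 1) (σ : ℝ)
    (alg : DetAlgorithm) (T : ℕ) :
    ∫⁻ w, ENNReal.ofReal (sys.state alg w T ^ 2) ∂(noise σ) ≤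
      ENNReal.ofReal (5 / 3 * σ ^ 2) + ENNReal.ofReal (2 * sys.b ^ 2) * ∑ t ∈ Finset.range T,
          ∫⁻ w, ENNReal.ofReal ((sys.action alg w t - K * sys.state alg w t) ^ 2) ∂(noise σ) := by
  induction T with
  | zero => simp [state_zero]
  | succ T ih =>
    rw [lintegral_state_succ_sq, Finset.sum_range_succ]
    set Z := ∑ t ∈ Finset.range T,
          ∫⁻ w, ENNReal.ofReal ((sys.action alg w t - K * sys.state alg w t) ^ 2) ∂(noise σ)
    set z := ∫⁻ w, ENNReal.ofReal ((sys.action alg w T - K * sys.state alg w T) ^ 2) ∂(noise σ)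
    have step : ∫⁻ w, ENNReal.ofReal ((sys.a * sys.state alg w T +
          sys.b * sys.action alg w T) ^ 2) ∂(noise σ) ≤
        ENNReal.ofReal (2 / 5) * ∫⁻ w, ENNReal.ofReal (sys.state alg w T ^ 2) ∂(noise σ) +
          ENNReal.ofReal (2 * sys.b ^ 2) * z := by
      rw [← lintegral_const_mul _ (by fun_prop), ← lintegral_const_mul _ (by fun_prop),
        ← lintegral_add_left (by fun_prop)]
      refine lintegral_mono fun w => ?_
      dsimp only
      rw [← ENNReal.ofReal_mul (by positivity), ← ENNReal.ofReal_mul (by positivity),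
        ← ENNReal.ofReal_add (by positivity) (by positivity)]
      refine ENNReal.ofReal_le_ofReal ?_
      -- Write ax + bu = (a+bK)x + b(u-Kx) and use (p+q)² ≤ 2p² + 2q². The factor 2(a+bK)² ≤ 2/5
      -- makes 5/3 the fixed point of v ↦ 2v/5 + 1.
      nlinarith [sq_nonneg ((sys.a + sys.b * K) * sys.state alg w T -
        sys.b * (sys.action alg w T - K * sys.state alg w T)),
        mul_le_mul_of_nonneg_right hρ (sq_nonneg (sys.state alg w T))]
    calc _ ≤ (ENNReal.ofReal (2 / 5) * (ENNReal.ofReal (5 / 3 * σ ^ 2) +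
          ENNReal.ofReal (2 * sys.b ^ 2) * Z) + ENNReal.ofReal (2 * sys.b ^ 2) * z) +
          ENNReal.ofReal (σ ^ 2) := by gcongr; exact step.trans (by gcongr)
      _ = (ENNReal.ofReal (2 / 5) * ENNReal.ofReal (5 / 3 * σ ^ 2) + ENNReal.ofReal (σ ^ 2)) +
          ENNReal.ofReal (2 * sys.b ^ 2) * (ENNReal.ofReal (2 / 5) * Z + z) := by ring
      _ ≤ _ := by
        gcongr
        · rw [← ENNReal.ofReal_mul (by positivity),
            ← ENNReal.ofReal_add (by positivity) (by positivity)]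
          exact ENNReal.ofReal_le_ofReal (by nlinarith)
        · exact mul_le_of_le_one_left' (by
            rw [← ENNReal.ofReal_one]; exact ENNReal.ofReal_le_ofReal (by norm_num))

/-! ### Bellman identity: optimal policy, optimal cost and regret decomposition -/

/-- `P x²` is the value function of the system and `u = K x` its greedy action. -/
def Bellman (P K : ℝ) : Prop :=
  0 < P ∧ |sys.a + sys.b * K| < 1 ∧ ∀ x u : ℝ,
    sys.q * x ^ 2 + sys.r * u ^ 2 + P * (sys.a * x + sys.b * u) ^ 2 =
      P * x ^ 2 + (sys.r + sys.b ^ 2 * P) * (u - K * x) ^ 2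

namespace Bellman

variable {sys} {P K : ℝ} (hB : sys.Bellman P K)

include hB

lemma policyCost_eq (σ : ℝ) : sys.policyCost σ K = ENNReal.ofReal (P * σ ^ 2) := by
  rw [policyCost_of_abs_lt_one _ _ _ hB.2.1]
  have h := hB.2.2 1 K
  have h1 : 0 < 1 - (sys.a + sys.b * K) ^ 2 := by
    have := (sq_lt_one_iff_abs_lt_one _).2 hB.2.1; linarith
  have h2 : sys.q + sys.r * K ^ 2 = P * (1 - (sys.a + sys.b * K) ^ 2) := by
    linear_combination h
  rw [h2]
  congr 1
  field_simp

/-- The Bellman identity at x = 1, u = K' exhibits the excess over Pσ² as a positive multiple of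
(K'-K)² when K' contracts; otherwise the cost is infinite. -/
lemma lt_policyCost {σ : ℝ} (hσ : 0 < σ) {K' : ℝ} (hK : K' ≠ K) :
    sys.policyCost σ K < sys.policyCost σ K' := by
  rw [hB.policyCost_eq]
  rcases lt_or_ge |sys.a + sys.b * K'| 1 with h | h
  · have hr := sys.r_pos
    have hP := hB.1
    rw [policyCost_of_abs_lt_one _ _ _ h]
    have h1 : 0 < 1 - (sys.a + sys.b * K') ^ 2 := by
      have := (sq_lt_one_iff_abs_lt_one _).2 h; linarith
    have h2 : sys.q + sys.r * K' ^ 2 = P * (1 - (sys.a + sys.b * K') ^ 2) +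
        (sys.r + sys.b ^ 2 * P) * (K' - K) ^ 2 := by
      linear_combination hB.2.2 1 K'
    have h3 : 0 < (K' - K) ^ 2 := by have := sub_ne_zero.2 hK; positivity
    have h4 : 0 < (sys.r + sys.b ^ 2 * P) * (K' - K) ^ 2 * (σ ^ 2 *
      (1 - (sys.a + sys.b * K') ^ 2)⁻¹) := by positivity
    have h5 : (sys.q + sys.r * K' ^ 2) * (σ ^ 2 * (1 - (sys.a + sys.b * K') ^ 2)⁻¹) = P * σ ^ 2 +
        (sys.r + sys.b ^ 2 * P) * (K' - K) ^ 2 * (σ ^ 2 *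
          (1 - (sys.a + sys.b * K') ^ 2)⁻¹) := by
      rw [h2]; field_simp
    rw [h5]
    exact (ENNReal.ofReal_lt_ofReal_iff (by positivity)).2 (by linarith)
  · rw [policyCost_of_one_le_abs _ hσ _ h]
    exact ENNReal.ofReal_lt_top

lemma isOptimalPolicy {σ : ℝ} (hσ : 0 < σ) : sys.IsOptimalPolicy σ K := fun K' => by
  rcases eq_or_ne K' K with rfl | h
  · rfl
  · exact (hB.lt_policyCost hσ h).le

lemma existsUnique_isOptimalPolicy {σ : ℝ} (hσ : 0 < σ) :
    ∃! K : ℝ, sys.IsOptimalPolicy σ K := by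
  refine ⟨K, hB.isOptimalPolicy hσ, fun K' h => ?_⟩
  by_contra hne
  exact (h K).not_gt (hB.lt_policyCost hσ hne)

lemma optimalCost_eq {σ : ℝ} (hσ : 0 < σ) : sys.optimalCost σ = ENNReal.ofReal (P * σ ^ 2) := by
  rw [← hB.policyCost_eq]
  exact le_antisymm (iInf_le _ _) (le_iInf fun K' => hB.isOptimalPolicy hσ K')

/-- The expected cumulative cost in terms of the deviations from the optimal policy. -/
lemma sum_lintegral_stepCost_add (σ : ℝ) (alg : DetAlgorithm) (T : ℕ) :
    ∑ t ∈ Finset.range T, ∫⁻ w, ENNReal.ofReal (sys.stepCost alg w t) ∂(noise σ) +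
        ENNReal.ofReal P * ∫⁻ w, ENNReal.ofReal (sys.state alg w T ^ 2) ∂(noise σ) =
      ENNReal.ofReal (sys.r + sys.b ^ 2 * P) * ∑ t ∈ Finset.range T,
          ∫⁻ w, ENNReal.ofReal ((sys.action alg w t - K * sys.state alg w t) ^ 2) ∂(noise σ) +
        T * ENNReal.ofReal (P * σ ^ 2) := by
  have hq := sys.q_pos
  have hr := sys.r_pos
  have hP := hB.1
  induction T with
  | zero => simp [state_zero]
  | succ T ih =>
    have step : ∫⁻ w, ENNReal.ofReal (sys.stepCost alg w T) ∂(noise σ) +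
        ENNReal.ofReal P * ∫⁻ w, ENNReal.ofReal ((sys.a * sys.state alg w T +
          sys.b * sys.action alg w T) ^ 2) ∂(noise σ) =
        ENNReal.ofReal P * ∫⁻ w, ENNReal.ofReal (sys.state alg w T ^ 2) ∂(noise σ) +
        ENNReal.ofReal (sys.r + sys.b ^ 2 * P) *
          ∫⁻ w, ENNReal.ofReal ((sys.action alg w T - K * sys.state alg w T) ^ 2) ∂(noise σ) := by
      rw [← lintegral_const_mul _ (by fun_prop), ← lintegral_const_mul _ (by fun_prop),
        ← lintegral_const_mul _ (by fun_prop), ← lintegral_add_left (by fun_prop),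
        ← lintegral_add_left (by fun_prop)]
      refine lintegral_congr fun w => ?_
      rw [← ENNReal.ofReal_mul hP.le, ← ENNReal.ofReal_mul hP.le,
        ← ENNReal.ofReal_mul (by positivity), ← ENNReal.ofReal_add (by unfold stepCost; positivity)
          (by positivity), ← ENNReal.ofReal_add (by positivity) (by positivity)]
      exact congrArg _ (hB.2.2 _ _)
    rw [Finset.sum_range_succ, Finset.sum_range_succ, lintegral_state_succ_sq, mul_add, mul_add,
      ← ENNReal.ofReal_mul hP.le, Nat.cast_succ, add_mul, one_mul]
    calc _ = ∑ t ∈ Finset.range T, ∫⁻ w, ENNReal.ofReal (sys.stepCost alg w t) ∂(noise σ) +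
          (∫⁻ w, ENNReal.ofReal (sys.stepCost alg w T) ∂(noise σ) +
          ENNReal.ofReal P * ∫⁻ w, ENNReal.ofReal ((sys.a * sys.state alg w T +
          sys.b * sys.action alg w T) ^ 2) ∂(noise σ)) + ENNReal.ofReal (P * σ ^ 2) := by ring
      _ = _ := by rw [step, ← add_assoc, ih]; ring

end Bellman

end LQR

/-! ### Riccati equation of the hard instance -/

/-- The Riccati equation of the hard instance. -/
lemma exists_riccati {ε : ℝ} (hε : 0 < ε) :
    ∃ P : ℝ, 1 ≤ P ∧ P ≤ 5 / 4 ∧ ε * P ^ 2 + (4 / 5 - ε) * P - 1 = 0 := by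
  have hc : ContinuousOn (fun P : ℝ => ε * P ^ 2 + (4 / 5 - ε) * P - 1) (Set.Icc 1 (5 / 4)) := by
    fun_prop
  -- The polynomial equals -1/5 at P = 1 and 5ε/16 at P = 5/4.
  obtain ⟨P, hP, h⟩ := intermediate_value_Icc (by norm_num) hc
    (show (0 : ℝ) ∈ _ from ⟨by norm_num, by nlinarith⟩)
  exact ⟨P, hP.1, hP.2, h⟩

lemma signValue_sq (χ : Bool) : signValue χ ^ 2 = 1 := by cases χ <;> simp [signValue]

/-- The gain of the optimal policy of the hard instance, up to its sign. -/
noncomputable def hardGain (ε P : ℝ) : ℝ := √ε * (1 / √5) * P / (1 + ε * P)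

/-- P depends on b² only, so the two signs share it and their gains are opposite. The closed loop
coefficient is a/(1+εP), smaller than a = 1/√5, whence the bound 5(a+bK)² ≤ 1. -/
lemma bellman_hardSystem {ε P : ℝ} (hε : 0 < ε) (hP : 1 ≤ P)
    (h : ε * P ^ 2 + (4 / 5 - ε) * P - 1 = 0) (χ : Bool) :
    (hardSystem ε χ).Bellman P (-(signValue χ * hardGain ε P)) ∧
      5 * ((hardSystem ε χ).a + (hardSystem ε χ).b * -(signValue χ * hardGain ε P)) ^ 2 ≤ 1 := by
  have h5 : √5 ^ 2 = 5 := Real.sq_sqrt (by norm_num)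
  have h5' : 0 < √5 := by positivity
  have hs : √ε ^ 2 = ε := Real.sq_sqrt hε.le
  have hχ := signValue_sq χ
  have hD : 0 < 1 + ε * P := by positivity
  have hρ : (hardSystem ε χ).a + (hardSystem ε χ).b * -(signValue χ * hardGain ε P) =
      1 / √5 / (1 + ε * P) := by
    simp only [hardSystem, hardGain]
    field_simp
    linear_combination (-(signValue χ ^ 2) * P) * hs - ε * P * hχ
  have hsq : 5 * ((hardSystem ε χ).a + (hardSystem ε χ).b * -(signValue χ * hardGain ε P)) ^ 2
      ≤ 1 := by
    rw [hρ, div_pow, div_pow, h5]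
    have : 1 ≤ (1 + ε * P) ^ 2 := one_le_pow₀ (by nlinarith)
    rw [one_pow, mul_div_assoc', mul_one_div_cancel (by norm_num)]
    exact (div_le_one (by positivity)).2 this
  refine ⟨⟨by linarith, ?_, fun x u => ?_⟩, hsq⟩
  · rw [← sq_lt_one_iff_abs_lt_one]; linarith
  · simp only [hardSystem, hardGain]
    have hb : (signValue χ * √ε) ^ 2 = ε := by rw [mul_pow, hχ, hs, one_mul]
    rw [hb]
    have ha : (1 / √5) ^ 2 = 1 / 5 := by rw [div_pow, h5, one_pow]
    set a := 1 / √5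
    set b := signValue χ * √ε
    have hK : ∀ D : ℝ, -(signValue χ * (√ε * a * P / D)) = -(b * a * P) / D := fun D => by
      ring
    rw [hK]
    clear_value a b
    field_simp
    linear_combination (u ^ 2 * (1 + ε * P) * P - x ^ 2 * a ^ 2 * P ^ 2) * hb +
      x ^ 2 * P * ha - x ^ 2 * h
-- Gaussian shifts and nondegeneracy
/-- Shifting a centred Gaussian amounts to an exponential change of density. -/
lemma lintegral_gaussianReal_shift {σ : ℝ} (hσ : 0 < σ) (m : ℝ) {f : ℝ → ℝ≥0∞}
    (hf : Measurable f) :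
    ∫⁻ y, f (m + y) ∂(gaussianReal 0 (σ ^ 2).toNNReal) =
      ∫⁻ y, f y * ENNReal.ofReal (Real.exp (m * y / σ ^ 2 - m ^ 2 / (2 * σ ^ 2)))
        ∂(gaussianReal 0 (σ ^ 2).toNNReal) := by
  have hv : (σ ^ 2).toNNReal ≠ 0 := by
    rw [Ne, Real.toNNReal_eq_zero, not_le]; positivity
  rw [← lintegral_map (μ := gaussianReal 0 (σ ^ 2).toNNReal) (g := fun y => m + y) hf
    (by fun_prop), gaussianReal_map_const_add, gaussianReal_of_var_ne_zero _ hv,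
    gaussianReal_of_var_ne_zero _ hv,
    lintegral_withDensity_eq_lintegral_mul _ (measurable_gaussianPDF _ _) hf,
    lintegral_withDensity_eq_lintegral_mul _ (measurable_gaussianPDF _ _) (by fun_prop)]
  refine lintegral_congr fun y => ?_
  have h : gaussianPDF (0 + m) (σ ^ 2).toNNReal y = gaussianPDF 0 (σ ^ 2).toNNReal y *
      ENNReal.ofReal (Real.exp (m * y / σ ^ 2 - m ^ 2 / (2 * σ ^ 2))) := by
    simp only [gaussianPDF]
    rw [← ENNReal.ofReal_mul (gaussianPDFReal_nonneg _ _ _)]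
    congr 1
    simp only [gaussianPDFReal, Real.coe_toNNReal _ (sq_nonneg σ)]
    rw [mul_assoc _⁻¹, ← Real.exp_add]
    congr 2
    field_simp
    ring
  simp only [Pi.mul_apply, h]
  ring

/-- A quantitative nondegeneracy of Gaussian variables, uniform in the mean. -/
lemma le_lintegral_gaussianReal_one_sub_cos {σ : ℝ} (hσ : 0 < σ) (m : ℝ) :
    ENNReal.ofReal (2 / 5 * σ) ≤
      ∫⁻ y, ENNReal.ofReal (σ * (1 - Real.cos (2 / σ * (m + y))) / 2)
        ∂(gaussianReal 0 (σ ^ 2).toNNReal) := by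
  set v := (σ ^ 2).toNNReal with hv
  have hmap : ∫⁻ y, ENNReal.ofReal (σ * (1 - Real.cos (2 / σ * (m + y))) / 2) ∂(gaussianReal 0 v) =
      ∫⁻ y, ENNReal.ofReal (σ * (1 - Real.cos (2 / σ * y)) / 2) ∂(gaussianReal m v) := by
    rw [← zero_add m, ← gaussianReal_map_const_add, lintegral_map (by fun_prop) (by fun_prop)]
    simp
  have hcos : Integrable (fun y : ℝ => Real.cos (2 / σ * y)) (gaussianReal m v) :=
    Integrable.of_bound (by fun_prop) 1 (ae_of_all _ fun y => by
      simpa using Real.abs_cos_le_one (2 / σ * y))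
  have hexp : Integrable (fun y : ℝ => Complex.exp (((2 / σ : ℝ) : ℂ) * y * Complex.I))
      (gaussianReal m v) :=
    Integrable.of_bound (by fun_prop) 1 (ae_of_all _ fun y => by
      rw [← Complex.ofReal_mul, Complex.norm_exp_ofReal_mul_I])
  -- At frequency 2/σ the characteristic function has modulus exp(-2) whatever the mean m. As
  -- exp(-2) ≤ 1/5, the bound is σ(1 - 1/5)/2 = 2σ/5.
  have hint : ∫ y, Real.cos (2 / σ * y) ∂(gaussianReal m v) ≤ Real.exp (-2) := by
    have h1 := charFun_gaussianReal (μ := m) (v := v) (2 / σ)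
    rw [charFun_apply_real] at h1
    have h2 : ∫ y, Real.cos (2 / σ * y) ∂(gaussianReal m v) =
        (∫ y, Complex.exp (((2 / σ : ℝ) : ℂ) * y * Complex.I) ∂(gaussianReal m v)).re := by
      have := integral_re hexp
      simp only [RCLike.re_to_complex] at this
      rw [← this]
      refine integral_congr_ae (ae_of_all _ fun y => ?_)
      dsimp only
      rw [← Complex.ofReal_mul, Complex.exp_ofReal_mul_I_re]
    rw [h2, h1]
    refine (Complex.re_le_norm _).trans ?_
    rw [Complex.norm_exp]
    refine Real.exp_le_exp.2 (le_of_eq ?_)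
    have h3 : (((2 / σ : ℝ) : ℂ) * (m : ℂ) * Complex.I - ((v : ℝ) : ℂ) * ((2 / σ : ℝ) : ℂ) ^ 2 / 2) =
        ((-2 : ℝ) : ℂ) + ((2 / σ * m : ℝ) : ℂ) * Complex.I := by
      rw [hv, Real.coe_toNNReal _ (sq_nonneg σ)]
      have hc : (σ : ℂ) ≠ 0 := by exact_mod_cast hσ.ne'
      push_cast
      field_simp
      ring
    rw [h3]
    simp
  have he : Real.exp (-2) ≤ 1 / 5 := by
    have h1 : (2.7 : ℝ) ≤ Real.exp 1 := by linarith [Real.exp_one_gt_d9]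
    have h2 : Real.exp 2 = Real.exp 1 ^ 2 := by rw [← Real.exp_nat_mul]; norm_num
    rw [Real.exp_neg, h2, inv_le_comm₀ (by positivity) (by norm_num)]
    nlinarith
  have hf : Integrable (fun y : ℝ => σ * (1 - Real.cos (2 / σ * y)) / 2) (gaussianReal m v) :=
    (((integrable_const _).sub hcos).const_mul _).div_const _
  rw [hmap, ← ofReal_integral_eq_lintegral_ofReal hf (ae_of_all _ fun y => by
    have := Real.cos_le_one (2 / σ * y)
    have : 0 ≤ 1 - Real.cos (2 / σ * y) := by linarith
    simp only [Pi.zero_apply]; positivity)]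
  refine ENNReal.ofReal_le_ofReal ?_
  rw [integral_div, integral_const_mul, integral_sub (integrable_const _) hcos]
  simp only [integral_const, probReal_univ, one_smul]
  nlinarith

/-! ### Change of measure to the system of gain 0 -/

namespace LQR

/-- The same system with another control gain `b`. -/
def withGain (sys : LQR) (b : ℝ) : LQR := { sys with b := b }

variable (sys : LQR) (alg : DetAlgorithm)

/-- Log-likelihood ratio of the observations, between the gain `b` and the gain `0`. -/
noncomputable def logLikelihood (σ b : ℝ) (w : ℕ → ℝ) (t : ℕ) : ℝ :=
  ∑ s ∈ Finset.range t, (b * (sys.withGain 0).action alg w s * w s / σ ^ 2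
    - (b * (sys.withGain 0).action alg w s) ^ 2 / (2 * σ ^ 2))

@[fun_prop]
lemma measurable_logLikelihood (σ b : ℝ) (t : ℕ) :
    Measurable (fun w => sys.logLikelihood alg σ b w t) := by
  unfold logLikelihood; fun_prop

lemma logLikelihood_update (σ b : ℝ) (w : ℕ → ℝ) (t : ℕ) (y : ℝ) :
    sys.logLikelihood alg σ b (Function.update w t y) t = sys.logLikelihood alg σ b w t := by
  refine Finset.sum_congr rfl fun s hs => ?_
  have hs' := Finset.mem_range.1 hs
  rw [action_update _ _ _ hs'.le, Function.update_of_ne hs'.ne]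

/-- Change of measure from the gain `b` to the gain `0`. -/
lemma lintegral_history_withGain {σ : ℝ} (hσ : 0 < σ) (b : ℝ) (t : ℕ)
    {F : (Fin (t + 1) → ℝ) → ℝ≥0∞} (hF : Measurable F) :
    ∫⁻ w, F ((sys.withGain b).history alg w t) ∂(noise σ) =
      ∫⁻ w, F ((sys.withGain 0).history alg w t) *
        ENNReal.ofReal (Real.exp (sys.logLikelihood alg σ b w t)) ∂(noise σ) := by
  induction t with
  | zero =>
    refine lintegral_congr fun w => ?_
    simp [logLikelihood, history]
  | succ t ih =>
    set γ := gaussianReal 0 (σ ^ 2).toNNReal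
    -- Integrand of the last round once bu_t has been absorbed into the noise: the next state
    -- becomes ax_t + y, as for gain 0, at the price of the exponential density. Integrating out y
    -- leaves a function of the history up to t, to which the induction hypothesis applies.
    let H : (Fin (t + 1) → ℝ) → ℝ → ℝ≥0∞ := fun h y =>
      F (Fin.snoc (α := fun _ => ℝ) h (sys.a * h (Fin.last t) + y)) *
        ENNReal.ofReal (Real.exp (b * alg.act t h * y / σ ^ 2 -
          (b * alg.act t h) ^ 2 / (2 * σ ^ 2)))
    have hact := alg.measurable_act t
    have hsnoc : Measurable (fun p : (Fin (t + 1) → ℝ) × ℝ => F (Fin.snoc (α := fun _ => ℝ) p.1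
        (sys.a * p.1 (Fin.last t) + p.2))) :=
      hF.comp ((measurable_finSnoc t).comp (measurable_fst.prodMk (by fun_prop)))
    have hH : Measurable (Function.uncurry H) := by
      refine hsnoc.mul ?_
      have : Measurable (fun p : (Fin (t + 1) → ℝ) × ℝ => alg.act t p.1) :=
        hact.comp measurable_fst
      fun_prop
    have hmeas : ∀ c, Measurable (fun w => (sys.withGain c).history alg w (t + 1)) := fun c =>
      (sys.withGain c).measurable_history alg (t + 1)
    have hmF : ∀ c, Measurable (fun w => F ((sys.withGain c).history alg w (t + 1))) := fun c =>
      hF.comp (hmeas c)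
    have hmR : Measurable (fun w => F ((sys.withGain 0).history alg w (t + 1)) *
        ENNReal.ofReal (Real.exp (sys.logLikelihood alg σ b w (t + 1)))) :=
      (hmF 0).mul (by fun_prop)
    rw [lintegral_noise_update σ t (hmF b), lintegral_noise_update σ t hmR]
    have hL : ∀ w, ∫⁻ y, F ((sys.withGain b).history alg (Function.update w t y) (t + 1)) ∂γ =
        ∫⁻ y, H ((sys.withGain b).history alg w t) y ∂γ := fun w => by
      set h := (sys.withGain b).history alg w t with hh
      rw [← lintegral_gaussianReal_shift hσ (b * alg.act t h)
        (f := fun y => F (Fin.snoc (α := fun _ => ℝ) h (sys.a * h (Fin.last t) + y)))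
        (hsnoc.comp measurable_prodMk_left)]
      refine lintegral_congr fun y => ?_
      simp only [history, history_update _ _ _ le_rfl, Function.update_self, ← hh]
      simp only [withGain, add_assoc]
    have hR : ∀ w, ∫⁻ y, F ((sys.withGain 0).history alg (Function.update w t y) (t + 1)) *
          ENNReal.ofReal (Real.exp
            (sys.logLikelihood alg σ b (Function.update w t y) (t + 1))) ∂γ =
        (∫⁻ y, H ((sys.withGain 0).history alg w t) y ∂γ) *
          ENNReal.ofReal (Real.exp (sys.logLikelihood alg σ b w t)) := fun w => by
      have hHy : Measurable (H ((sys.withGain 0).history alg w t)) := hH.of_uncurry_left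
      rw [← lintegral_mul_const _ hHy]
      refine lintegral_congr fun y => ?_
      have hl : sys.logLikelihood alg σ b (Function.update w t y) (t + 1) =
          sys.logLikelihood alg σ b w t +
            (b * (sys.withGain 0).action alg w t * y / σ ^ 2 -
              (b * (sys.withGain 0).action alg w t) ^ 2 / (2 * σ ^ 2)) := by
        conv_rhs => rw [← sys.logLikelihood_update alg σ b w t y]
        rw [logLikelihood, Finset.sum_range_succ, action_update _ _ _ le_rfl,
          Function.update_self]
        rfl
      rw [hl, Real.exp_add, ENNReal.ofReal_mul (Real.exp_pos _).le]
      simp only [H, history, history_update _ _ _ le_rfl, Function.update_self, action]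
      simp only [withGain, zero_mul, add_zero]
      ring
    rw [lintegral_congr hL, lintegral_congr hR]
    exact ih (F := fun h => ∫⁻ y, H h y ∂γ) hH.lintegral_prod_right'

end LQR

/-! ### Overlap of the two signs and the dichotomy -/

/-- AM-GM with B in the role of √(XY): products of the deviations under the two signs are controlled
by their risks. -/
lemma two_mul_abs_mul_le {X Y B p q : ℝ} (hX : 0 ≤ X) (hY : 0 ≤ Y) (h : X * Y = B ^ 2) :
    2 * (|p * q| * B) ≤ p ^ 2 * X + q ^ 2 * Y := by
  refine le_trans (le_abs_self _) (abs_le_of_sq_le_sq ?_ (by positivity))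
  have h1 : (2 * (|p * q| * B)) ^ 2 = 4 * (p ^ 2 * X) * (q ^ 2 * Y) := by
    rw [mul_pow, mul_pow, sq_abs, ← h]; ring
  rw [h1]
  nlinarith [sq_nonneg (p ^ 2 * X - q ^ 2 * Y)]

namespace LQR

variable (sys : LQR) (alg : DetAlgorithm)

/-- The geometric mean of the likelihood ratios of the gains `b` and `-b`. -/
noncomputable def overlap (σ b : ℝ) (w : ℕ → ℝ) (t : ℕ) : ℝ :=
  Real.exp (-∑ s ∈ Finset.range t, (b * (sys.withGain 0).action alg w s) ^ 2 / (2 * σ ^ 2))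

@[fun_prop]
lemma measurable_overlap (σ b : ℝ) (t : ℕ) : Measurable (fun w => sys.overlap alg σ b w t) := by
  unfold overlap; fun_prop

lemma overlap_pos (σ b : ℝ) (w : ℕ → ℝ) (t : ℕ) : 0 < sys.overlap alg σ b w t := Real.exp_pos _

lemma overlap_antitone (σ b : ℝ) (w : ℕ → ℝ) : Antitone (sys.overlap alg σ b w) := by
  intro s t hst
  refine Real.exp_le_exp.2 (neg_le_neg ?_)
  exact Finset.sum_le_sum_of_subset_of_nonneg (Finset.range_mono hst) fun _ _ _ => by positivity

lemma overlap_zero (σ b : ℝ) (w : ℕ → ℝ) : sys.overlap alg σ b w 0 = 1 := by simp [overlap]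

lemma overlap_le_one (σ b : ℝ) (w : ℕ → ℝ) (t : ℕ) : sys.overlap alg σ b w t ≤ 1 :=
  (sys.overlap_antitone alg σ b w t.zero_le).trans_eq (sys.overlap_zero alg σ b w)

/-- The terms linear in the noise cancel between b and -b; only the action energy remains. -/
lemma exp_logLikelihood_mul (σ b : ℝ) (w : ℕ → ℝ) (t : ℕ) :
    Real.exp (sys.logLikelihood alg σ b w t) * Real.exp (sys.logLikelihood alg σ (-b) w t) =
      sys.overlap alg σ b w t ^ 2 := by
  rw [overlap, ← Real.exp_add, ← Real.exp_nat_mul, logLikelihood, logLikelihood,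
    ← Finset.sum_add_distrib, mul_neg, Finset.mul_sum, ← Finset.sum_neg_distrib]
  congr 1
  refine Finset.sum_congr rfl fun s _ => ?_
  push_cast
  ring

/-- Large actions make the two signs of the gain distinguishable. -/
lemma one_sub_overlap_le {σ : ℝ} (b : ℝ) (w : ℕ → ℝ) (T : ℕ) :
    1 - sys.overlap alg σ b w T ≤ ∑ t ∈ Finset.range T,
      sys.overlap alg σ b w t * ((b * (sys.withGain 0).action alg w t) ^ 2 / (2 * σ ^ 2)) := by
  induction T with
  | zero => simp [overlap_zero]
  | succ T ih =>
    rw [Finset.sum_range_succ]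
    set d := (b * (sys.withGain 0).action alg w T) ^ 2 / (2 * σ ^ 2) with hd
    have h : sys.overlap alg σ b w (T + 1) = sys.overlap alg σ b w T * Real.exp (-d) := by
      rw [overlap, Finset.sum_range_succ, neg_add, Real.exp_add, overlap]
    -- The overlap falls by B_T(1 - exp(-d)) ≤ B_T d in one round.
    have h1 := Real.add_one_le_exp (-d)
    have h2 := sys.overlap_pos alg σ b w T
    rw [h]
    nlinarith

/-- The expected squared deviations in round `t` from the policy of gain `-k` in the system of
gain `b`, and from the policy of gain `k` in the system of gain `-b`. -/
noncomputable def pairRisk (σ b k : ℝ) (t : ℕ) : ℝ≥0∞ :=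
  ∫⁻ w, ENNReal.ofReal (((sys.withGain b).action alg w t +
      k * (sys.withGain b).state alg w t) ^ 2) ∂(noise σ) +
    ∫⁻ w, ENNReal.ofReal (((sys.withGain (-b)).action alg w t -
      k * (sys.withGain (-b)).state alg w t) ^ 2) ∂(noise σ)

variable {σ : ℝ} (hσ : 0 < σ)

include hσ

lemma lintegral_exp_logLikelihood (b : ℝ) (t : ℕ) :
    ∫⁻ w, ENNReal.ofReal (Real.exp (sys.logLikelihood alg σ b w t)) ∂(noise σ) = 1 := by
  have := sys.lintegral_history_withGain alg hσ b t (F := fun _ => 1) measurable_const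
  simpa using this.symm

lemma pairRisk_eq (b k : ℝ) (t : ℕ) :
    sys.pairRisk alg σ b k t = ∫⁻ w, ENNReal.ofReal
      (((sys.withGain 0).action alg w t + k * (sys.withGain 0).state alg w t) ^ 2 *
          Real.exp (sys.logLikelihood alg σ b w t) +
        ((sys.withGain 0).action alg w t - k * (sys.withGain 0).state alg w t) ^ 2 *
          Real.exp (sys.logLikelihood alg σ (-b) w t)) ∂(noise σ) := by
  have hact := alg.measurable_act t
  have h : ∀ b k : ℝ, ∫⁻ w, ENNReal.ofReal (((sys.withGain b).action alg w t +
      k * (sys.withGain b).state alg w t) ^ 2) ∂(noise σ) = ∫⁻ w, ENNReal.ofReal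
      (((sys.withGain 0).action alg w t + k * (sys.withGain 0).state alg w t) ^ 2) *
          ENNReal.ofReal (Real.exp (sys.logLikelihood alg σ b w t)) ∂(noise σ) := fun b k =>
    sys.lintegral_history_withGain alg hσ b t
      (F := fun h => ENNReal.ofReal ((alg.act t h + k * h (Fin.last t)) ^ 2)) (by fun_prop)
  have h' := h (-b) (-k)
  simp only [neg_mul, ← sub_eq_add_neg] at h'
  rw [pairRisk, h, h', ← lintegral_add_left (by fun_prop)]
  refine lintegral_congr fun w => ?_
  rw [ENNReal.ofReal_add (by positivity) (by positivity), ENNReal.ofReal_mul (by positivity),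
    ENNReal.ofReal_mul (by positivity)]

/-- No action is close to both -kx and kx: 2k|x| ≤ |u+kx| + |u-kx|. Each term, weighted by B, is
split by AM-GM against the constant M; the likelihood ratios integrate to 1, which produces 2M. -/
lemma lintegral_abs_state_mul_overlap_le (b : ℝ) {k M : ℝ} (hk : 0 ≤ k) (hM : 0 < M) (t : ℕ) :
    ∫⁻ w, ENNReal.ofReal (4 * k * (|(sys.withGain 0).state alg w t| *
        sys.overlap alg σ b w t)) ∂(noise σ) ≤
      ENNReal.ofReal M⁻¹ * sys.pairRisk alg σ b k t + ENNReal.ofReal (2 * M) := by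
  have h2 : ENNReal.ofReal (2 * M) =
      ∫⁻ w, (ENNReal.ofReal M * ENNReal.ofReal (Real.exp (sys.logLikelihood alg σ b w t)) +
        ENNReal.ofReal M *
          ENNReal.ofReal (Real.exp (sys.logLikelihood alg σ (-b) w t))) ∂(noise σ) := by
    rw [lintegral_add_left (by fun_prop), lintegral_const_mul _ (by fun_prop),
      lintegral_const_mul _ (by fun_prop), lintegral_exp_logLikelihood _ _ hσ,
      lintegral_exp_logLikelihood _ _ hσ, mul_one, ← ENNReal.ofReal_add hM.le hM.le, two_mul]
  rw [h2, pairRisk_eq _ _ hσ, ← lintegral_const_mul _ (by fun_prop),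
    ← lintegral_add_left (by fun_prop)]
  refine lintegral_mono fun w => ?_
  dsimp only
  rw [← ENNReal.ofReal_mul (by positivity), ← ENNReal.ofReal_mul (by positivity),
    ← ENNReal.ofReal_mul (by positivity), ← ENNReal.ofReal_add (by positivity) (by positivity),
    ← ENNReal.ofReal_add (by positivity) (by positivity)]
  refine ENNReal.ofReal_le_ofReal ?_
  have hXY := sys.exp_logLikelihood_mul alg σ b w t
  have hB := sys.overlap_pos alg σ b w t
  set u := (sys.withGain 0).action alg w t
  set x := (sys.withGain 0).state alg w t
  set B := sys.overlap alg σ b w t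
  have hX := Real.exp_pos (sys.logLikelihood alg σ b w t)
  have hY := Real.exp_pos (sys.logLikelihood alg σ (-b) w t)
  set X := Real.exp (sys.logLikelihood alg σ b w t)
  set Y := Real.exp (sys.logLikelihood alg σ (-b) w t)
  have h1 := two_mul_abs_mul_le (p := u + k * x) (q := M) hX.le hY.le hXY
  have h3 := two_mul_abs_mul_le (p := M) (q := u - k * x) hX.le hY.le hXY
  have h4 : 2 * (k * |x|) ≤ |u + k * x| + |u - k * x| := by
    have : |(u + k * x) - (u - k * x)| ≤ _ := abs_sub _ _
    have h5 : |(u + k * x) - (u - k * x)| = 2 * (k * |x|) := by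
      rw [show (u + k * x) - (u - k * x) = 2 * k * x by ring, abs_mul, abs_of_nonneg (by positivity)]
      ring
    linarith
  rw [abs_mul, abs_of_pos hM] at h1 h3
  have h6 : M * (4 * k * (|x| * B)) ≤ (u + k * x) ^ 2 * X + (u - k * x) ^ 2 * Y +
      M ^ 2 * (X + Y) := by
    nlinarith [mul_le_mul_of_nonneg_left h4 (by positivity : 0 ≤ 2 * M * B)]
  calc 4 * k * (|x| * B) = M⁻¹ * (M * (4 * k * (|x| * B))) := by field_simp
    _ ≤ M⁻¹ * ((u + k * x) ^ 2 * X + (u - k * x) ^ 2 * Y + M ^ 2 * (X + Y)) := by gcongr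
    _ = _ := by field_simp

/-- AM-GM bounds 2B|(u+kx)(u-kx)| by the two risks, and (u+kx)(u-kx) = u² - k²x². So action energy
beyond what the policies ±k would spend counts as deviation. -/
lemma lintegral_overlap_mul_action_sq_le (b k : ℝ) (t : ℕ) :
    ∫⁻ w, ENNReal.ofReal (2 * (sys.overlap alg σ b w t * (sys.withGain 0).action alg w t ^ 2))
        ∂(noise σ) ≤ sys.pairRisk alg σ b k t + ENNReal.ofReal (2 * k ^ 2) *
      ∫⁻ w, ENNReal.ofReal ((sys.withGain 0).state alg w t ^ 2) ∂(noise σ) := by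
  rw [pairRisk_eq _ _ hσ, ← lintegral_const_mul _ (by fun_prop),
    ← lintegral_add_left (by fun_prop)]
  refine lintegral_mono fun w => ?_
  dsimp only
  rw [← ENNReal.ofReal_mul (by positivity), ← ENNReal.ofReal_add (by positivity) (by positivity)]
  refine ENNReal.ofReal_le_ofReal ?_
  have hXY := sys.exp_logLikelihood_mul alg σ b w t
  have hB := sys.overlap_pos alg σ b w t
  have hB1 := sys.overlap_le_one alg σ b w t
  set u := (sys.withGain 0).action alg w t
  set x := (sys.withGain 0).state alg w t
  set B := sys.overlap alg σ b w t
  have h1 := two_mul_abs_mul_le (p := u + k * x) (q := u - k * x)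
    (Real.exp_pos (sys.logLikelihood alg σ b w t)).le
    (Real.exp_pos (sys.logLikelihood alg σ (-b) w t)).le hXY
  have h2 := mul_le_mul_of_nonneg_right (le_abs_self ((u + k * x) * (u - k * x))) hB.le
  nlinarith [mul_le_mul_of_nonneg_right hB1 (sq_nonneg (k * x))]

/-- The test function σ sin²(x/σ) lies below both |x| and σ. Its mean is at least 2σ/5 by the fresh
noise w_t, and its boundedness lets the weight B_T be removed at a cost of σ(1 - B_T), with no
independence needed. -/
lemma le_lintegral_abs_state_mul_overlap (b : ℝ) {t T : ℕ} (ht : t + 1 ≤ T) :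
    ENNReal.ofReal (2 / 5 * σ) ≤
      ∫⁻ w, ENNReal.ofReal (|(sys.withGain 0).state alg w (t + 1)| *
        sys.overlap alg σ b w (t + 1)) ∂(noise σ) +
      ENNReal.ofReal σ * ∫⁻ w, ENNReal.ofReal (1 - sys.overlap alg σ b w T) ∂(noise σ) := by
  have h1 : ENNReal.ofReal (2 / 5 * σ) ≤ ∫⁻ w, ENNReal.ofReal
      (σ * (1 - Real.cos (2 / σ * (sys.withGain 0).state alg w (t + 1))) / 2) ∂(noise σ) := by
    rw [lintegral_noise_update σ t (by fun_prop)]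
    simp only [state_succ, state_update _ _ _ le_rfl, action_update _ _ _ le_rfl,
      Function.update_self]
    calc ENNReal.ofReal (2 / 5 * σ) = ∫⁻ w, ENNReal.ofReal (2 / 5 * σ) ∂(noise σ) := by simp
      _ ≤ _ := lintegral_mono fun w => le_lintegral_gaussianReal_one_sub_cos hσ _
  refine h1.trans ?_
  rw [← lintegral_const_mul _ (by fun_prop), ← lintegral_add_left (by fun_prop)]
  refine lintegral_mono fun w => ?_
  dsimp only
  have hB := sys.overlap_pos alg σ b w T
  have hB1 := sys.overlap_le_one alg σ b w T
  have hBt := sys.overlap_antitone alg σ b w ht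
  have hBt0 := sys.overlap_pos alg σ b w (t + 1)
  rw [← ENNReal.ofReal_mul hσ.le, ← ENNReal.ofReal_add (by positivity)
    (mul_nonneg hσ.le (by linarith))]
  refine ENNReal.ofReal_le_ofReal ?_
  set x := (sys.withGain 0).state alg w (t + 1)
  set B := sys.overlap alg σ b w T
  have hx : σ * (1 - Real.cos (2 / σ * x)) / 2 ≤ |x| := by
    have h2 : Real.cos (2 / σ * x) = 1 - 2 * Real.sin (x / σ) ^ 2 := by
      rw [show 2 / σ * x = 2 * (x / σ) by ring, Real.cos_two_mul, Real.cos_sq']; ring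
    have h3 : |Real.sin (x / σ)| ≤ |x| / σ := by
      simpa [abs_div, abs_of_pos hσ] using Real.abs_sin_le_abs (x := x / σ)
    have h4 : Real.sin (x / σ) ^ 2 ≤ |Real.sin (x / σ)| := by
      rw [← sq_abs]
      exact pow_le_of_le_one (abs_nonneg _) (Real.abs_sin_le_one _) two_ne_zero
    rw [h2]
    calc _ = σ * Real.sin (x / σ) ^ 2 := by ring
      _ ≤ σ * (|x| / σ) := by gcongr; exact h4.trans h3
      _ = |x| := by field_simp
  have hx' : σ * (1 - Real.cos (2 / σ * x)) / 2 ≤ σ := by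
    nlinarith [Real.neg_one_le_cos (2 / σ * x)]
  nlinarith [mul_le_mul_of_nonneg_right hx hB.le, mul_le_mul_of_nonneg_left hBt (abs_nonneg x),
    mul_le_mul_of_nonneg_right hx' (by linarith : 0 ≤ 1 - B)]

omit hσ in
-- Under gain 0 the actions do not matter, and 5σ²/4 is the fixed point of v ↦ v/5 + σ².
lemma lintegral_state_withGain_zero_sq_le (ha : 5 * sys.a ^ 2 ≤ 1) (t : ℕ) :
    ∫⁻ w, ENNReal.ofReal ((sys.withGain 0).state alg w t ^ 2) ∂(noise σ) ≤
      ENNReal.ofReal (5 / 4 * σ ^ 2) := by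
  induction t with
  | zero => simp [state_zero]
  | succ t ih =>
    rw [lintegral_state_succ_sq]
    calc _ ≤ ENNReal.ofReal (1 / 5) * ENNReal.ofReal (5 / 4 * σ ^ 2) + ENNReal.ofReal (σ ^ 2) := by
          gcongr
          refine le_trans ?_ (mul_le_mul_right ih _)
          rw [← lintegral_const_mul _ (by fun_prop)]
          refine lintegral_mono fun w => ?_
          dsimp only
          rw [← ENNReal.ofReal_mul (by positivity)]
          refine ENNReal.ofReal_le_ofReal ?_
          simp only [withGain, zero_mul, add_zero, mul_pow]
          gcongr
          linarith
      _ = _ := by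
          rw [← ENNReal.ofReal_mul (by positivity),
            ← ENNReal.ofReal_add (by positivity) (by positivity)]
          congr 1; ring

/-- Either the actions are large, or the two signs of the gain cannot be told apart; in both cases
the deviations from the two policies are large. -/
lemma le_sum_pairRisk (ha : 5 * sys.a ^ 2 ≤ 1) {b k : ℝ} (hb : b ≠ 0) (hk : 0 < k) (T : ℕ)
    {g : ℝ}
    (h1 : g ≤ σ ^ 2 / (10 * b ^ 2) - 5 / 2 * k ^ 2 * T * σ ^ 2)
    (h2 : g ≤ 9 / 32 * k ^ 2 * σ ^ 2 * (T - 1)) :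
    ENNReal.ofReal g ≤ ∑ t ∈ Finset.range T, sys.pairRisk alg σ b k t := by
  rcases eq_or_ne (∑ t ∈ Finset.range T, sys.pairRisk alg σ b k t) ⊤ with htop | htop
  · rw [htop]; exact le_top
  have hδtop : ∫⁻ w, ENNReal.ofReal (1 - sys.overlap alg σ b w T) ∂(noise σ) ≠ ⊤ := by
    refine ne_top_of_le_ne_top ENNReal.one_ne_top ?_
    calc _ ≤ ∫⁻ _, 1 ∂(noise σ) := lintegral_mono fun w => by
          rw [← ENNReal.ofReal_one]
          exact ENNReal.ofReal_le_ofReal (by linarith [sys.overlap_pos alg σ b w T])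
      _ = 1 := by simp
  obtain ⟨δ, hδ⟩ : ∃ δ : ℝ, 0 ≤ δ ∧
      ∫⁻ w, ENNReal.ofReal (1 - sys.overlap alg σ b w T) ∂(noise σ) = ENNReal.ofReal δ :=
    ⟨_, ENNReal.toReal_nonneg, (ENNReal.ofReal_toReal hδtop).symm⟩
  obtain ⟨hδ0, hδ⟩ := hδ
  obtain ⟨G, hG0, hG⟩ : ∃ G : ℝ, 0 ≤ G ∧
      ∑ t ∈ Finset.range T, sys.pairRisk alg σ b k t = ENNReal.ofReal G :=
    ⟨_, ENNReal.toReal_nonneg, (ENNReal.ofReal_toReal htop).symm⟩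
  -- The threshold 1/40 leaves 2/5 - 1/40 = 3/8 in the indistinguishable case.
  rcases le_total (1 / 40) δ with hcase | hcase
  · rw [hG]
    refine ENNReal.ofReal_le_ofReal (h1.trans ?_)
    have hsum : ENNReal.ofReal (4 * σ ^ 2 / b ^ 2 * δ) ≤
        ENNReal.ofReal (G + T * (2 * k ^ 2 * (5 / 4 * σ ^ 2))) := by
      calc ENNReal.ofReal (4 * σ ^ 2 / b ^ 2 * δ) = ∫⁻ w, ENNReal.ofReal (4 * σ ^ 2 / b ^ 2) *
            ENNReal.ofReal (1 - sys.overlap alg σ b w T) ∂(noise σ) := by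
            rw [lintegral_const_mul _ (by fun_prop), hδ, ENNReal.ofReal_mul (by positivity)]
        _ ≤ ∫⁻ w, ∑ t ∈ Finset.range T, ENNReal.ofReal (2 * (sys.overlap alg σ b w t *
              (sys.withGain 0).action alg w t ^ 2)) ∂(noise σ) := by
            refine lintegral_mono fun w => ?_
            dsimp only
            have hBt := sys.overlap_pos alg σ b w
            rw [← ENNReal.ofReal_mul (by positivity),
              ← ENNReal.ofReal_sum_of_nonneg fun t _ => by have := hBt t; positivity]
            refine ENNReal.ofReal_le_ofReal ?_
            refine (mul_le_mul_of_nonneg_left (sys.one_sub_overlap_le alg b w T)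
              (by positivity)).trans_eq ?_
            rw [Finset.mul_sum]
            refine Finset.sum_congr rfl fun t _ => ?_
            field_simp
            ring
        _ ≤ ∑ t ∈ Finset.range T, (sys.pairRisk alg σ b k t +
              ENNReal.ofReal (2 * k ^ 2 * (5 / 4 * σ ^ 2))) := by
            rw [lintegral_finsetSum _ fun t _ => by fun_prop]
            refine Finset.sum_le_sum fun t _ => ?_
            refine (sys.lintegral_overlap_mul_action_sq_le alg hσ b k t).trans ?_
            rw [ENNReal.ofReal_mul (by positivity : 0 ≤ 2 * k ^ 2)]
            gcongr
            exact sys.lintegral_state_withGain_zero_sq_le alg ha t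
        _ = _ := by
            rw [Finset.sum_add_distrib, hG, Finset.sum_const, Finset.card_range, nsmul_eq_mul,
              ENNReal.ofReal_add hG0 (by positivity),
              ENNReal.ofReal_mul (p := (T : ℝ)) (by positivity), ENNReal.ofReal_natCast]
    have hreal := (ENNReal.ofReal_le_ofReal_iff (by positivity)).1 hsum
    have h3 : σ ^ 2 / (10 * b ^ 2) ≤ 4 * σ ^ 2 / b ^ 2 * δ := by
      calc σ ^ 2 / (10 * b ^ 2) = 4 * σ ^ 2 / b ^ 2 * (1 / 40) := by field_simp; norm_num
        _ ≤ _ := by gcongr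
    linarith
  -- With this M the lower bound 4k(2/5 - δ)σ is at least 4M, so 4M ≤ G'/M + 2M and each risk is at
  -- least 2M². Round 0 is left out because x_0 = 0, hence the T - 1.
  · set M := 3 / 8 * k * σ with hM
    have hM0 : 0 < M := by positivity
    have hstep : ∀ t < T - 1, ENNReal.ofReal (2 * M ^ 2) ≤ sys.pairRisk alg σ b k (t + 1) := by
      intro t ht
      rcases eq_or_ne (sys.pairRisk alg σ b k (t + 1)) ⊤ with htop' | htop'
      · rw [htop']; exact le_top
      obtain ⟨G', hG0', hG'⟩ : ∃ G : ℝ, 0 ≤ G ∧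
          sys.pairRisk alg σ b k (t + 1) = ENNReal.ofReal G :=
        ⟨_, ENNReal.toReal_nonneg, (ENNReal.ofReal_toReal htop').symm⟩
      have e1 := sys.le_lintegral_abs_state_mul_overlap alg hσ b (t := t) (T := T) (by omega)
      have e2 := sys.lintegral_abs_state_mul_overlap_le alg hσ b hk.le hM0 (t + 1)
      simp_rw [ENNReal.ofReal_mul (by positivity : 0 ≤ 4 * k)] at e2
      rw [lintegral_const_mul _ (by fun_prop)] at e2
      rw [hG'] at e2 ⊢
      have e3 : ENNReal.ofReal (4 * k * (2 / 5 * σ)) ≤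
          ENNReal.ofReal (M⁻¹ * G' + 2 * M + 4 * k * (σ * δ)) := by
        rw [ENNReal.ofReal_mul (p := 4 * k) (q := 2 / 5 * σ) (by positivity),
          ENNReal.ofReal_add (by positivity) (by positivity),
          ENNReal.ofReal_add (by positivity) (by positivity),
          ENNReal.ofReal_mul (p := M⁻¹) (by positivity),
          ENNReal.ofReal_mul (p := 4 * k) (q := σ * δ) (by positivity), ENNReal.ofReal_mul hσ.le,
          ← hδ]
        refine (mul_le_mul_right e1 _).trans ?_
        rw [mul_add]
        gcongr
      have e4 := (ENNReal.ofReal_le_ofReal_iff (by positivity)).1 e3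
      refine ENNReal.ofReal_le_ofReal ?_
      have e5 : 2 * M ≤ M⁻¹ * G' := by
        have : 4 * k * (σ * δ) ≤ 4 * k * (σ * (1 / 40)) := by gcongr
        rw [hM] at e4 ⊢
        linarith
      calc 2 * M ^ 2 = M * (2 * M) := by ring
        _ ≤ M * (M⁻¹ * G') := by gcongr
        _ = G' := by field_simp
    rcases Nat.eq_zero_or_pos T with rfl | hT
    · simp only [CharP.cast_eq_zero] at h2
      rw [ENNReal.ofReal_of_nonpos (by nlinarith [sq_nonneg (k * σ)])]
      exact zero_le
    obtain ⟨n, rfl⟩ : ∃ n, T = n + 1 := ⟨T - 1, by omega⟩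
    calc ENNReal.ofReal g ≤ ENNReal.ofReal (n * (2 * M ^ 2)) := by
          refine ENNReal.ofReal_le_ofReal (h2.trans (le_of_eq ?_))
          rw [hM]; push_cast; ring
      _ = ∑ t ∈ Finset.range n, ENNReal.ofReal (2 * M ^ 2) := by
          rw [Finset.sum_const, Finset.card_range, nsmul_eq_mul,
            ENNReal.ofReal_mul (by positivity), ENNReal.ofReal_natCast]
      _ ≤ ∑ t ∈ Finset.range n, sys.pairRisk alg σ b k (t + 1) :=
          Finset.sum_le_sum fun t ht => hstep t (by simpa using ht)
      _ ≤ _ := by rw [Finset.sum_range_succ']; exact le_self_add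

end LQR

/-! ### From deviations to expected regret -/

/-- Rests on C + (C-D)⁻ = (C-D)⁺ + D. The negative part is at most D, so the difference defining
`expect` is never ∞ - ∞. Superadditivity of the integral suffices, so C need not be measurable. -/
lemma le_expect_sub_const {Ω : Type*} [MeasurableSpace Ω] (μ : Measure Ω) [IsProbabilityMeasure μ]
    {C : Ω → ℝ} (hC : ∀ ω, 0 ≤ C ω) {D y e : ℝ} (hD : 0 ≤ D) (hy : 0 ≤ y) (he : 0 ≤ e)
    (h : ENNReal.ofReal (D + y) ≤ ∫⁻ ω, ENNReal.ofReal (C ω) ∂μ + ENNReal.ofReal e) :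
    ((y - e : ℝ) : EReal) ≤ expect μ (fun ω => C ω - D) := by
  unfold expect
  set p := ∫⁻ ω, ENNReal.ofReal (C ω - D) ∂μ with hp
  set n := ∫⁻ ω, ENNReal.ofReal (-(C ω - D)) ∂μ with hn
  have hnD : n ≤ ENNReal.ofReal D := by
    calc n ≤ ∫⁻ _, ENNReal.ofReal D ∂μ :=
          lintegral_mono fun ω => ENNReal.ofReal_le_ofReal (by linarith [hC ω])
      _ = ENNReal.ofReal D := by simp
  have hn' : n ≠ ⊤ := ne_top_of_le_ne_top ENNReal.ofReal_ne_top hnD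
  have hsum : ∫⁻ ω, ENNReal.ofReal (C ω) ∂μ + n ≤ p + ENNReal.ofReal D := by
    calc _ ≤ ∫⁻ ω, (ENNReal.ofReal (C ω) + ENNReal.ofReal (-(C ω - D))) ∂μ := le_lintegral_add _ _
      _ = ∫⁻ ω, (ENNReal.ofReal (C ω - D) + ENNReal.ofReal D) ∂μ := by
          refine lintegral_congr fun ω => ?_
          rcases le_total D (C ω) with hcd | hcd
          · rw [ENNReal.ofReal_of_nonpos (by linarith : -(C ω - D) ≤ 0),
              ← ENNReal.ofReal_add (by linarith) hD]
            simp
          · rw [ENNReal.ofReal_of_nonpos (by linarith : C ω - D ≤ 0),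
              ← ENNReal.ofReal_add (hC ω) (by linarith)]
            simp
      _ = _ := by rw [lintegral_add_right _ measurable_const]; simp [hp]
  clear_value n p
  lift n to ℝ≥0 using hn'
  rcases eq_or_ne p ⊤ with hp' | hp'
  · rw [hp']
    have : ((⊤ : ℝ≥0∞) : EReal) - (((n : ℝ≥0) : ℝ≥0∞) : EReal) = ⊤ := EReal.top_sub_coe (n : ℝ)
    rw [this]
    exact le_top
  · lift p to ℝ≥0 using hp'
    have h1 : ENNReal.ofReal (D + y) + n ≤ p + ENNReal.ofReal D + ENNReal.ofReal e := by
      refine (add_le_add_left h _).trans ?_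
      rw [add_right_comm]
      gcongr
    have h2 : ENNReal.ofReal (D + y + n) ≤ ENNReal.ofReal (p + D + e) := by
      rw [ENNReal.ofReal_add (by positivity) (by positivity), ENNReal.ofReal_add (by positivity) he,
        ENNReal.ofReal_add (by positivity) hD, ENNReal.ofReal_coe_nnreal,
        ENNReal.ofReal_coe_nnreal]
      exact h1
    have h3 := (ENNReal.ofReal_le_ofReal_iff (by positivity)).1 h2
    have h4 : (((p : ℝ≥0∞) : EReal) - ((n : ℝ≥0∞) : EReal)) = (((p : ℝ) - (n : ℝ) : ℝ) : EReal) := rfl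
    rw [h4]
    exact EReal.coe_le_coe_iff.2 (by linarith)

namespace LQR

lemma regret_eq (sys : LQR) (σ : ℝ) (alg : DetAlgorithm) (T : ℕ) (w : ℕ → ℝ) :
    sys.regret σ alg T w = ∑ t ∈ Finset.range T, sys.stepCost alg w t -
      T * (sys.optimalCost σ).toReal := by
  simp [regret, Finset.sum_sub_distrib]

lemma stepCost_nonneg (sys : LQR) (alg : DetAlgorithm) (w : ℕ → ℝ) (t : ℕ) :
    0 ≤ sys.stepCost alg w t := by
  have := sys.q_pos
  have := sys.r_pos
  unfold stepCost; positivity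

/-- The expected cumulative cost of `T` rounds. -/
noncomputable def totalCost (sys : LQR) (σ : ℝ) (alg : DetAlgorithm) (T : ℕ) : ℝ≥0∞ :=
  ∫⁻ w, ENNReal.ofReal (∑ t ∈ Finset.range T, sys.stepCost alg w t) ∂(noise σ)

lemma totalCost_eq_sum (sys : LQR) (σ : ℝ) (alg : DetAlgorithm) (T : ℕ) :
    sys.totalCost σ alg T =
      ∑ t ∈ Finset.range T, ∫⁻ w, ENNReal.ofReal (sys.stepCost alg w t) ∂(noise σ) := by
  unfold totalCost
  simp_rw [ENNReal.ofReal_sum_of_nonneg fun t _ => sys.stepCost_nonneg alg _ t]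
  exact lintegral_finsetSum _ fun t _ => by fun_prop

/-- The expected total squared deviation from the policy `u = K x`. -/
noncomputable def totalDeviation (sys : LQR) (σ K : ℝ) (alg : DetAlgorithm) (T : ℕ) : ℝ≥0∞ :=
  ∑ t ∈ Finset.range T,
    ∫⁻ w, ENNReal.ofReal ((sys.action alg w t - K * sys.state alg w t) ^ 2) ∂(noise σ)

/-- A crude bound that serves finiteness: when the cost is finite so is the deviation, and the
regret identity may be rearranged in ℝ. -/
lemma totalDeviation_le {sys : LQR} (hq : sys.q = 1) (hr : sys.r = 1) {K : ℝ} (hK : K ^ 2 ≤ 1)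
    (σ : ℝ) (alg : DetAlgorithm) (T : ℕ) :
    sys.totalDeviation σ K alg T ≤ 2 * sys.totalCost σ alg T := by
  rw [totalCost_eq_sum, totalDeviation, Finset.mul_sum]
  refine Finset.sum_le_sum fun t _ => ?_
  rw [← lintegral_const_mul _ (by fun_prop)]
  refine lintegral_mono fun w => ?_
  dsimp only
  rw [← ENNReal.ofReal_ofNat 2, ← ENNReal.ofReal_mul (by norm_num)]
  refine ENNReal.ofReal_le_ofReal ?_
  rw [stepCost, hq, hr]
  nlinarith [sq_nonneg (sys.action alg w t + K * sys.state alg w t),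
    mul_le_mul_of_nonneg_right hK (sq_nonneg (sys.state alg w t))]

/-- Inserting the bound on 𝔼 x_T² into the telescoped identity leaves (1 - b²P) Z with b²P ≤ 1/2,
and an error of P·5σ²/3 ≤ 25σ²/12. -/
lemma Bellman.le_totalCost {sys : LQR} {P K : ℝ} (hB : sys.Bellman P K) (hq : sys.q = 1)
    (hr : sys.r = 1) (hK : K ^ 2 ≤ 1) (hP : P ≤ 5 / 4) (hb : sys.b ^ 2 ≤ 2 / 5)
    (hρ : 5 * (sys.a + sys.b * K) ^ 2 ≤ 1) (σ : ℝ) (alg : DetAlgorithm) (T : ℕ) :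
    ENNReal.ofReal (1 / 2) * sys.totalDeviation σ K alg T + ENNReal.ofReal (T * (P * σ ^ 2)) ≤
      sys.totalCost σ alg T + ENNReal.ofReal (4 * σ ^ 2) := by
  have hP0 := hB.1
  rcases eq_or_ne (sys.totalCost σ alg T) ⊤ with htop | htop
  · rw [htop, top_add]; exact le_top
  have hZtop : sys.totalDeviation σ K alg T ≠ ⊤ :=
    ne_top_of_le_ne_top (ENNReal.mul_ne_top (by simp) htop) (totalDeviation_le hq hr hK σ alg T)
  have e1 := hB.sum_lintegral_stepCost_add σ alg T
  have e2 := sys.lintegral_state_sq_le hρ σ alg T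
  rw [← totalCost_eq_sum, ← totalDeviation, hr] at e1
  rw [← totalDeviation] at e2
  obtain ⟨z, hz0, hz⟩ : ∃ z : ℝ, 0 ≤ z ∧ sys.totalDeviation σ K alg T = ENNReal.ofReal z :=
    ⟨_, ENNReal.toReal_nonneg, (ENNReal.ofReal_toReal hZtop).symm⟩
  obtain ⟨c, hc0, hc⟩ : ∃ c : ℝ, 0 ≤ c ∧ sys.totalCost σ alg T = ENNReal.ofReal c :=
    ⟨_, ENNReal.toReal_nonneg, (ENNReal.ofReal_toReal htop).symm⟩
  rw [hz] at e1 e2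
  rw [hc] at e1
  have e3 : ENNReal.ofReal ((1 + sys.b ^ 2 * P) * z + T * (P * σ ^ 2)) ≤
      ENNReal.ofReal (c + P * (5 / 3 * σ ^ 2 + 2 * sys.b ^ 2 * z)) := by
    rw [ENNReal.ofReal_add (by positivity) (by positivity), ENNReal.ofReal_mul (by positivity),
      ENNReal.ofReal_mul (p := (T : ℝ)) (by positivity), ENNReal.ofReal_natCast, ← e1,
      ENNReal.ofReal_add hc0 (by positivity), ENNReal.ofReal_mul hP0.le,
      ENNReal.ofReal_add (by positivity) (by positivity),
      ENNReal.ofReal_mul (p := 2 * sys.b ^ 2) (by positivity)]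
    gcongr
  have e4 := (ENNReal.ofReal_le_ofReal_iff (by positivity)).1 e3
  rw [hz, hc, ← ENNReal.ofReal_mul (by positivity),
    ← ENNReal.ofReal_add (by positivity) (by positivity),
    ← ENNReal.ofReal_add (by positivity) (by positivity)]
  refine ENNReal.ofReal_le_ofReal ?_
  have e5 : sys.b ^ 2 * P ≤ 1 / 2 := by nlinarith [sq_nonneg sys.b]
  nlinarith [mul_le_mul_of_nonneg_right e5 hz0, mul_le_mul_of_nonneg_right hP (sq_nonneg σ)]

end LQR

/-! ### Lower bounds for the hard instance -/

lemma hardGain_sq {ε P : ℝ} (hε : 0 < ε) :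
    hardGain ε P ^ 2 = ε / 5 * (P / (1 + ε * P)) ^ 2 := by
  have h5 : √5 ^ 2 = 5 := Real.sq_sqrt (by norm_num)
  have hs : √ε ^ 2 = ε := Real.sq_sqrt hε.le
  rw [hardGain, div_pow, div_pow, mul_pow, mul_pow, div_pow, hs, h5]
  ring

/-- The total cost of the two signs together, against any deterministic algorithm. -/
lemma le_totalCost_hardSystem_add {σ : ℝ} (hσ : 0 < σ) {T : ℕ} (hT : 12000 ≤ T) {ε P : ℝ}
    (hε : ε = 1 / (4 * √(T : ℝ))) (hP1 : 1 ≤ P) (hP2 : P ≤ 5 / 4)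
    (hP : ε * P ^ 2 + (4 / 5 - ε) * P - 1 = 0) (alg : DetAlgorithm) :
    2 * ENNReal.ofReal (T * (P * σ ^ 2) + σ ^ 2 * √(T : ℝ) / 3100) ≤
      (hardSystem ε true).totalCost σ alg T + (hardSystem ε false).totalCost σ alg T +
        2 * ENNReal.ofReal (4 * σ ^ 2) := by
  have hT' : (12000 : ℝ) ≤ T := by exact_mod_cast hT
  set s := √(T : ℝ) with hs
  have hsT : s ^ 2 = T := Real.sq_sqrt (by positivity)
  have hs100 : 100 ≤ s := Real.le_sqrt_of_sq_le (by linarith)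
  have hs0 : 0 < s := by linarith
  have hε0 : 0 < ε := by rw [hε]; positivity
  have hεs : ε * s = 1 / 4 := by rw [hε]; field_simp
  have hε1 : ε ≤ 1 / 400 := by nlinarith
  set k := hardGain ε P with hk
  have hk2 : k ^ 2 = ε / 5 * (P / (1 + ε * P)) ^ 2 := hardGain_sq hε0
  have hD1 : 1 ≤ 1 + ε * P := by nlinarith
  have hR0 : 0 ≤ P / (1 + ε * P) := by positivity
  have hR1 : P / (1 + ε * P) ≤ 5 / 4 := (div_le_self (by linarith) hD1).trans hP2
  have hR2 : 99 / 100 ≤ P / (1 + ε * P) := by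
    rw [le_div_iff₀ (by linarith)]; nlinarith
  have hkle : k ^ 2 ≤ 5 / 16 * ε := by
    rw [hk2]; nlinarith [pow_le_pow_left₀ hR0 hR1 2]
  have hkge : ε / 6 ≤ k ^ 2 := by
    rw [hk2]; nlinarith [pow_le_pow_left₀ (by norm_num) hR2 2]
  have hk0 : 0 < k := by rw [hk, hardGain]; positivity
  have hsε : √ε ^ 2 = ε := Real.sq_sqrt hε0.le
  have h5 : √5 ^ 2 = 5 := Real.sq_sqrt (by norm_num)
  have hbound : ∀ χ, ENNReal.ofReal (1 / 2) *
      (hardSystem ε χ).totalDeviation σ (-(signValue χ * k)) alg T +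
        ENNReal.ofReal (T * (P * σ ^ 2)) ≤
      (hardSystem ε χ).totalCost σ alg T + ENNReal.ofReal (4 * σ ^ 2) := fun χ => by
    obtain ⟨hB, hρ⟩ := bellman_hardSystem hε0 hP1 hP χ
    refine hB.le_totalCost rfl rfl ?_ hP2 ?_ hρ σ alg T
    · rw [neg_sq, mul_pow, signValue_sq, one_mul]; linarith
    · change (signValue χ * √ε) ^ 2 ≤ _
      rw [mul_pow, signValue_sq, one_mul, hsε]; linarith
  have hpair : (hardSystem ε true).totalDeviation σ (-(signValue true * k)) alg T +
      (hardSystem ε false).totalDeviation σ (-(signValue false * k)) alg T =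
      ∑ t ∈ Finset.range T, (hardSystem ε true).pairRisk alg σ (√ε) k t := by
    have ht : hardSystem ε true = (hardSystem ε true).withGain (√ε) := by
      simp [hardSystem, LQR.withGain, signValue]
    have hf : hardSystem ε false = (hardSystem ε true).withGain (-√ε) := by
      simp [hardSystem, LQR.withGain, signValue]
    simp only [LQR.totalDeviation, LQR.pairRisk, ← ht, ← hf, Finset.sum_add_distrib]
    simp [signValue]
  -- The choice of ε makes 1/b² and k²T both of order √T. The first alternative gives (2/5 -
  -- 25/128)σ²√T, the second 9/768·σ²(√T - 1/√T); both exceed σ²√T/100.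
  have hrisk : ENNReal.ofReal (σ ^ 2 * s / 100) ≤
      ∑ t ∈ Finset.range T, (hardSystem ε true).pairRisk alg σ (√ε) k t := by
    have hσ2 : 0 < σ ^ 2 := by positivity
    refine LQR.le_sum_pairRisk _ alg hσ ?_ (by positivity) hk0 T ?_ ?_
    · change 5 * (1 / √5) ^ 2 ≤ 1
      rw [div_pow, h5]; norm_num
    · rw [hsε, hε, ← hsT]
      have e1 : σ ^ 2 / (10 * (1 / (4 * s))) = 2 / 5 * s * σ ^ 2 := by field_simp; norm_num
      have e2 : k ^ 2 * s ^ 2 ≤ 5 / 64 * s := by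
        calc k ^ 2 * s ^ 2 ≤ 5 / 16 * ε * s ^ 2 := by gcongr
          _ = 5 / 16 * (ε * s) * s := by ring
          _ = _ := by rw [hεs]; ring
      rw [e1]
      nlinarith [mul_le_mul_of_nonneg_right e2 hσ2.le, mul_pos hs0 hσ2]
    · have e3 : s / 100 ≤ 9 / 32 * (ε / 6) * (T - 1) := by
        rw [← hsT, hε]
        have : 9 / 32 * (1 / (4 * s) / 6) * (s ^ 2 - 1) = 9 / 768 * (s - 1 / s) := by
          field_simp; ring
        have h1s : 1 / s ≤ 1 := by rw [div_le_one hs0]; linarith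
        rw [this]; linarith
      calc σ ^ 2 * s / 100 = s / 100 * σ ^ 2 := by ring
        _ ≤ 9 / 32 * (ε / 6) * (T - 1) * σ ^ 2 := by gcongr
        _ ≤ 9 / 32 * k ^ 2 * (T - 1) * σ ^ 2 := by
          have : (0 : ℝ) ≤ T - 1 := by linarith
          gcongr
        _ = _ := by ring
  rw [← hpair] at hrisk
  -- Averaging over the sign and the factor 1/2 in front of the deviations turn 1/100 into 1/400,
  -- well above 1/3100.
  calc 2 * ENNReal.ofReal (T * (P * σ ^ 2) + σ ^ 2 * s / 3100)
      ≤ 2 * (ENNReal.ofReal (1 / 4) * ENNReal.ofReal (σ ^ 2 * s / 100) +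
          ENNReal.ofReal (T * (P * σ ^ 2))) := by
        rw [← ENNReal.ofReal_mul (by norm_num),
          ← ENNReal.ofReal_add (by positivity) (by positivity)]
        refine mul_le_mul_right (ENNReal.ofReal_le_ofReal ?_) _
        linarith [mul_pos (pow_pos hσ 2) hs0]
    _ = ENNReal.ofReal (1 / 2) * ENNReal.ofReal (σ ^ 2 * s / 100) +
          2 * ENNReal.ofReal (T * (P * σ ^ 2)) := by
        have : ENNReal.ofReal (1 / 2) = 2 * ENNReal.ofReal (1 / 4) := by
          rw [← ENNReal.ofReal_ofNat 2, ← ENNReal.ofReal_mul (by norm_num)]; norm_num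
        rw [this]; ring
    _ ≤ ENNReal.ofReal (1 / 2) *
          ((hardSystem ε true).totalDeviation σ (-(signValue true * k)) alg T +
          (hardSystem ε false).totalDeviation σ (-(signValue false * k)) alg T) +
          2 * ENNReal.ofReal (T * (P * σ ^ 2)) := by gcongr
    _ = _ := by rw [mul_add, two_mul]; exact add_add_add_comm _ _ _ _
    _ ≤ _ := add_le_add (hbound true) (hbound false)
    _ = _ := by rw [two_mul]; exact add_add_add_comm _ _ _ _

lemma lintegral_fairSign (f : Bool → ℝ≥0∞) :
    ∫⁻ χ, f χ ∂fairSign = 2⁻¹ * (f true + f false) := by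
  unfold fairSign
  rw [lintegral_fintype]
  simp [mul_comm, add_mul]

instance isProbabilityMeasure_fairSign : IsProbabilityMeasure fairSign := by
  unfold fairSign; infer_instance

lemma rpow_neg_half_div_four (T : ℕ) : (T : ℝ) ^ (-(1 / 2) : ℝ) / 4 = 1 / (4 * √(T : ℝ)) := by
  rw [Real.rpow_neg (by positivity), ← Real.sqrt_eq_rpow, div_eq_mul_inv, one_div, mul_inv,
    mul_comm]

lemma optimalCost_hardSystem {σ ε P : ℝ} (hσ : 0 < σ) (hε : 0 < ε) (hP1 : 1 ≤ P)
    (hP : ε * P ^ 2 + (4 / 5 - ε) * P - 1 = 0) (χ : Bool) :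
    (hardSystem ε χ).optimalCost σ = ENNReal.ofReal (P * σ ^ 2) :=
  (bellman_hardSystem hε hP1 hP χ).1.optimalCost_eq hσ

lemma regret_hardSystem {σ ε P : ℝ} (hσ : 0 < σ) (hε : 0 < ε) (hP1 : 1 ≤ P)
    (hP : ε * P ^ 2 + (4 / 5 - ε) * P - 1 = 0) (χ : Bool) (alg : DetAlgorithm) (T : ℕ)
    (w : ℕ → ℝ) : (hardSystem ε χ).regret σ alg T w =
      ∑ t ∈ Finset.range T, (hardSystem ε χ).stepCost alg w t - T * (P * σ ^ 2) := by
  rw [LQR.regret_eq, optimalCost_hardSystem hσ hε hP1 hP, ENNReal.toReal_ofReal (by positivity)]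

/-- The lower bound for the random instance. -/
lemma le_expect_regret_hardSystem {σ : ℝ} (hσ : 0 < σ) {T : ℕ} (hT : 12000 ≤ T)
    (alg : DetAlgorithm) :
    ((σ ^ 2 * √(T : ℝ) / 3100 - 4 * σ ^ 2 : ℝ) : EReal) ≤
      expect (fairSign.prod (noise σ))
        (fun p => (hardSystem ((T : ℝ) ^ (-(1 / 2) : ℝ) / 4) p.1).regret σ alg T p.2) := by
  rw [rpow_neg_half_div_four]
  have hT0 : (0 : ℝ) < T := by exact_mod_cast (by omega : 0 < T)
  obtain ⟨ε, hε⟩ : ∃ ε : ℝ, ε = 1 / (4 * √(T : ℝ)) := ⟨_, rfl⟩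
  rw [← hε]
  have hε0 : 0 < ε := by rw [hε]; positivity
  obtain ⟨P, hP1, hP2, hP⟩ := exists_riccati hε0
  simp only [regret_hardSystem hσ hε0 hP1 hP]
  refine le_expect_sub_const _ (fun p => Finset.sum_nonneg fun t _ => LQR.stepCost_nonneg _ _ _ _)
    (by positivity) (by positivity) (by positivity) ?_
  have hmeas : Measurable (fun p : Bool × (ℕ → ℝ) =>
      ENNReal.ofReal (∑ t ∈ Finset.range T, (hardSystem ε p.1).stepCost alg p.2 t)) := by
    have h : ∀ χ, Measurable (fun w : ℕ → ℝ =>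
        ENNReal.ofReal (∑ t ∈ Finset.range T, (hardSystem ε χ).stepCost alg w t)) := fun χ => by
      fun_prop
    exact measurable_from_prod_countable_right h
  have hI : ∫⁻ p, ENNReal.ofReal (∑ t ∈ Finset.range T, (hardSystem ε p.1).stepCost alg p.2 t)
      ∂(fairSign.prod (noise σ)) =
      2⁻¹ * ((hardSystem ε true).totalCost σ alg T + (hardSystem ε false).totalCost σ alg T) := by
    rw [lintegral_prod _ hmeas.aemeasurable]
    exact lintegral_fairSign fun χ => (hardSystem ε χ).totalCost σ alg T
  rw [hI]
  have h := mul_le_mul_right (le_totalCost_hardSystem_add hσ hT hε hP1 hP2 hP alg) 2⁻¹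
  rwa [mul_add, ENNReal.inv_mul_cancel_left' (by simp) (by simp),
    ENNReal.inv_mul_cancel_left' (by simp) (by simp)] at h

/-- Against any randomized algorithm, one of the two signs is bad. -/
lemma exists_le_expectedRegret_hardSystem {σ : ℝ} (hσ : 0 < σ) {T : ℕ} (hT : 12000 ≤ T)
    {ε P : ℝ} (hε : ε = 1 / (4 * √(T : ℝ))) (hP1 : 1 ≤ P) (hP2 : P ≤ 5 / 4)
    (hP : ε * P ^ 2 + (4 / 5 - ε) * P - 1 = 0)
    {S : Type*} [MeasurableSpace S] (ρ : Measure S) [IsProbabilityMeasure ρ] (alg : Algorithm S) :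
    ∃ χ : Bool, ((σ ^ 2 * √(T : ℝ) / 3100 - 4 * σ ^ 2 : ℝ) : EReal) ≤
      (hardSystem ε χ).expectedRegret σ ρ alg T := by
  have hT0 : (0 : ℝ) < T := by exact_mod_cast (by omega : 0 < T)
  have hε0 : 0 < ε := by rw [hε]; positivity
  let I : Bool → ℝ≥0∞ := fun χ => ∫⁻ p, ENNReal.ofReal (∑ t ∈ Finset.range T,
    (hardSystem ε χ).stepCost (alg.ofSeed p.1) p.2 t) ∂(ρ.prod (noise σ))
  have hmeas : ∀ χ, Measurable (fun p : S × (ℕ → ℝ) => ENNReal.ofReal (∑ t ∈ Finset.range T,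
      (hardSystem ε χ).stepCost (alg.ofSeed p.1) p.2 t)) := fun χ =>
    (Finset.measurable_fun_sum _ fun t _ =>
      (hardSystem ε χ).measurable_stepCost_seed alg t).ennreal_ofReal
  have hI : ∀ χ, I χ = ∫⁻ s, (hardSystem ε χ).totalCost σ (alg.ofSeed s) T ∂ρ := fun χ =>
    lintegral_prod _ (hmeas χ).aemeasurable
  have hsum : 2 * ENNReal.ofReal (T * (P * σ ^ 2) + σ ^ 2 * √(T : ℝ) / 3100) ≤
      I true + I false + 2 * ENNReal.ofReal (4 * σ ^ 2) := by
    have hm : Measurable (fun s => (hardSystem ε true).totalCost σ (alg.ofSeed s) T) :=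
      (hmeas true).lintegral_prod_right'
    rw [hI, hI, ← lintegral_add_left hm]
    calc _ = ∫⁻ _, 2 * ENNReal.ofReal (T * (P * σ ^ 2) + σ ^ 2 * √(T : ℝ) / 3100) ∂ρ := by simp
      _ ≤ ∫⁻ s, ((hardSystem ε true).totalCost σ (alg.ofSeed s) T +
          (hardSystem ε false).totalCost σ (alg.ofSeed s) T +
            2 * ENNReal.ofReal (4 * σ ^ 2)) ∂ρ := lintegral_mono fun s =>
          le_totalCost_hardSystem_add hσ hT hε hP1 hP2 hP (alg.ofSeed s)
      _ = _ := by rw [lintegral_add_right _ measurable_const]; simp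
  -- Both signs have the same optimal cost, so an inequality for the sum of the two costs passes to
  -- one of them.
  obtain ⟨χ, hχ⟩ : ∃ χ, ENNReal.ofReal (T * (P * σ ^ 2) + σ ^ 2 * √(T : ℝ) / 3100) ≤
      I χ + ENNReal.ofReal (4 * σ ^ 2) := by
    by_contra! hcon
    have h := ENNReal.add_lt_add (hcon true) (hcon false)
    rw [← two_mul, add_add_add_comm, ← two_mul] at h
    exact h.not_ge hsum
  refine ⟨χ, ?_⟩
  unfold LQR.expectedRegret
  simp only [regret_hardSystem hσ hε0 hP1 hP]
  exact le_expect_sub_const _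
    (fun p => Finset.sum_nonneg fun t _ => LQR.stepCost_nonneg _ _ _ _)
    (by positivity) (by positivity) (by positivity) hχ

lemma stabilizedBy_zero_hardSystem (σ ε : ℝ) (χ : Bool) : (hardSystem ε χ).StabilizedBy σ 0 := by
  have h5 : √5 ^ 2 = 5 := Real.sq_sqrt (by norm_num)
  have h : |(hardSystem ε χ).a + (hardSystem ε χ).b * 0| < 1 := by
    rw [mul_zero, add_zero, ← sq_lt_one_iff_abs_lt_one]
    change (1 / √5) ^ 2 < 1
    rw [div_pow, h5]; norm_num
  refine ⟨h, ?_⟩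
  rw [LQR.policyCost_of_abs_lt_one _ _ _ h]
  exact ENNReal.ofReal_lt_top

lemma hasBounds_hardSystem {σ ε P : ℝ} (hσ : 0 < σ) (hε : 0 < ε) (hε1 : ε ≤ 1) (hP1 : 1 ≤ P)
    (hP2 : P ≤ 5 / 4) (hP : ε * P ^ 2 + (4 / 5 - ε) * P - 1 = 0) (χ : Bool) :
    (hardSystem ε χ).HasBounds σ 1 1 1 (2 * σ ^ 2) := by
  have h5 : √5 ^ 2 = 5 := Real.sq_sqrt (by norm_num)
  refine ⟨by simp [hardSystem], by simp [hardSystem], by simp [hardSystem], by simp [hardSystem],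
    ?_, ?_, ?_⟩
  · rw [← sq_le_one_iff_abs_le_one]
    change (1 / √5) ^ 2 ≤ 1
    rw [div_pow, h5]; norm_num
  · rw [← sq_le_one_iff_abs_le_one]
    change (signValue χ * √ε) ^ 2 ≤ 1
    rwa [mul_pow, signValue_sq, one_mul, Real.sq_sqrt hε.le]
  · rw [optimalCost_hardSystem hσ hε hP1 hP]
    exact ENNReal.ofReal_le_ofReal (by nlinarith [sq_nonneg σ])

lemma controllable_hardSystem {ε : ℝ} (hε : 0 < ε) (χ : Bool) :
    (hardSystem ε χ).Controllable := by
  have : 0 < √ε := by positivity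
  cases χ <;> simp [LQR.Controllable, hardSystem, signValue, this.ne']

end ScalarControl

theorem theorem3 :
    -- any learning algorithm, which may depend on `σ` and `T` and receives `a` as input
    (∃ c : ℝ, 0 < c ∧ ∃ T₀ : ℕ, ∀ σ : ℝ, 0 < σ → ∀ T : ℕ, T₀ ≤ T →
      ∀ (S : Type*) [MeasurableSpace S] (ρ : Measure S) [IsProbabilityMeasure ρ]
        (alg : ℝ → ScalarControl.Algorithm S),
        ∃ sys : ScalarControl.LQR,
          sys.Controllable ∧
          (∃! K : ℝ, sys.IsOptimalPolicy σ K) ∧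
          sys.StabilizedBy σ 0 ∧
          sys.HasBounds σ 1 1 1 (2 * σ ^ 2) ∧
          ((c * (σ ^ 2 * √(T : ℝ)) : ℝ) : EReal) ≤ sys.expectedRegret σ ρ (alg sys.a) T) ∧
    -- the random instance, against any deterministic algorithm
    (∀ σ : ℝ, 0 < σ → ∀ T : ℕ, 12000 ≤ T → ∀ alg : ScalarControl.DetAlgorithm,
      ((σ ^ 2 * √(T : ℝ) / 3100 - 4 * σ ^ 2 : ℝ) : EReal) ≤
        ScalarControl.expect (ScalarControl.fairSign.prod (ScalarControl.noise σ))
          (fun p => (ScalarControl.hardSystem ((T : ℝ) ^ (-(1 / 2) : ℝ) / 4) p.1).regret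
            σ alg T p.2)) := by
  refine ⟨⟨1 / 6200, by norm_num, 1000000000, ?_⟩, fun σ hσ T hT alg =>
    ScalarControl.le_expect_regret_hardSystem hσ hT alg⟩
  intro σ hσ T hT S _ ρ _ alg
  have hT' : (1000000000 : ℝ) ≤ T := by exact_mod_cast hT
  -- From √T ≥ 24800 = 4·6200 on, half of σ²√T/3100 absorbs the term 4σ².
  have hs : 24800 ≤ √(T : ℝ) := Real.le_sqrt_of_sq_le (by linarith)
  obtain ⟨ε, hε⟩ : ∃ ε : ℝ, ε = 1 / (4 * √(T : ℝ)) := ⟨_, rfl⟩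
  have hε0 : 0 < ε := by rw [hε]; positivity
  have hε1 : ε ≤ 1 := by rw [hε, div_le_one (by positivity)]; linarith
  obtain ⟨P, hP1, hP2, hP⟩ := ScalarControl.exists_riccati hε0
  -- Both signs have a = 1/√5, so receiving a reveals nothing and a single algorithm faces both
  -- systems.
  obtain ⟨χ, hχ⟩ := ScalarControl.exists_le_expectedRegret_hardSystem hσ (by omega : 12000 ≤ T)
    hε hP1 hP2 hP ρ (alg (1 / √5))
  refine ⟨ScalarControl.hardSystem ε χ, ScalarControl.controllable_hardSystem hε0 χ,
    (ScalarControl.bellman_hardSystem hε0 hP1 hP χ).1.existsUnique_isOptimalPolicy hσ,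
    ScalarControl.stabilizedBy_zero_hardSystem σ ε χ,
    ScalarControl.hasBounds_hardSystem hσ hε0 hε1 hP1 hP2 hP χ, le_trans ?_ hχ⟩
  refine EReal.coe_le_coe_iff.2 ?_
  nlinarith [mul_le_mul_of_nonneg_left hs (sq_nonneg σ)]
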